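/- **Setting.** All logarithms are to base $2$. Fix a universal set $\mathcal G$ of elementary quantum gates: unitaries on at most $K$ qubits ($K$ a constant) such that every unitary on any number of qubits is approximated arbitrarily well (up to a global phase, possibly with ancillas that start in $|0\rangle$ and are returned to $|0\rangle$) by circuits over $\mathcal G$. Assume that NOT, Hadamard and Toffoli are each implemented by some circuit over $\mathcal G$ without error (up to a global phase, ancillas allowed as above), as is the case for the standard set consisting of Hadamard, CNOT and $\pi/8$ gates. A *distinguisher of size $s$* on $n$ qubits appends some number of ancilla qubits in state $|0\rangle$, applies a circuit $U$ of (at most) $s$ gates of $\mathcal G$, and measures the first qubit; $\mathbb E[D(\rho)]$ is the probability of outcome $1$. Let $\mathcal X,\mathcal B$ be state spaces with $\dim\mathcal X=N$, $\dim\mathcal B=L$, held in $m$ and $\ell$ qubits by labelling their basis states with distinct bit strings (for $N=2^m$, $L=2^\ell$ these are just the spaces of $m$ and $\ell$ qubits); distinguishers on $\mathcal X\otimes\mathcal B$ act on these $m+\ell$ qubits. For density operators let $D_\infty(\rho\|\sigma)=\inf\{\lambda\in\mathbb R:\rho\le 2^\lambda\sigma\}$ and $$H_{\min}(X|B)_\rho=\log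 N-\inf_{\tau_B} D_\infty\bigl(\rho_{XB}\,\big\|\,\tfrac1N I_X\otimes\tau_B\bigr),$$ where $\tau_B$ ranges over the density operators on $\mathcal B$. For $s\in\mathbb N$ and real $\varepsilon,k$: * $H^{\mathrm{rHILL}}_{s,\varepsilon}(X|B)_\rho\ge k$ means: there is a density operator $\sigma_{XB}$ with $H_{\min}(X|B)_\sigma\ge k$ and $|\mathbb E[D(\rho)]-\mathbb E[D(\sigma)]|\le\varepsilon$ for all distinguishers $D$ of size $s$. $H^{\mathrm{HILL}}_{s,\varepsilon}(X|B)_\rho\ge k$ means the same with the additional requirement $\sigma_B=\rho_B$. * $H^{\mathrm{metric\text{-}rlx}}_{s,\varepsilon}(X|B)_\rho\ge k$ means: for every distinguisher $D$ of size $s$ there is a density operator $\sigma_{XB}$ with $H_{\min}(X|B)_\sigma\ge k$ and $|\mathbb E[D(\rho)]-\mathbb E[D(\sigma)]|<\varepsilon$. $H^{\mathrm{metric}}_{s,\varepsilon}(X|B)_\rho\ge k$ means the same with the additional requirement $\sigma_B=\rho_B$. **Theorem ((relaxed-)metric to (relaxed-)HILL).** There is a constant $C>0$ depending only on $\mathcal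 G$ such that for all $N,L$, all bipartite states $\rho_{XB}$ on $\mathcal X\otimes\mathcal B$, all real $k,\varepsilon$, all $\delta>0$ and all $s,s'\in\mathbb N$ with $$s\ \ge\ s'\cdot C\,\frac{\log N+\log L}{\delta^2}:$$ if $H^{\mathrm{metric}}_{s,\varepsilon}(X|B)_\rho\ge k$, then $H^{\mathrm{HILL}}_{s',\varepsilon+\delta}(X|B)_\rho\ge k$; and if $H^{\mathrm{metric\text{-}rlx}}_{s,\varepsilon}(X|B)_\rho\ge k$, then $H^{\mathrm{rHILL}}_{s',\varepsilon+\delta}(X|B)_\rho\ge k$. -/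

import Mathlib

open scoped Kronecker ComplexOrder

namespace QuantumPseudoentropy

noncomputable section

/-! ### States and min-entropy -/

/-- Density operators on `ℂ^d`: positive semidefinite matrices of trace one. -/
def IsDensity {d : Type} [Fintype d] (ρ : Matrix d d ℂ) : Prop :=
  ρ.PosSemidef ∧ ρ.trace = 1

/-- The reduced state `ρ_B = tr_X ρ_{XB}`. -/
def traceX {N L : ℕ} (ρ : Matrix (Fin N × Fin L) (Fin N × Fin L) ℂ) :
    Matrix (Fin L) (Fin L) ℂ :=
  Matrix.of fun b b' => ∑ x, ρ (x, b) (x, b')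

/-- Relative min-entropy `D_∞(ρ‖σ) = inf {r ∈ ℝ : ρ ≤ 2^r σ}`, an extended real (the infimum of
the empty set is `+∞`). -/
def relMinEntropy {d : Type} [Fintype d] (ρ σ : Matrix d d ℂ) : EReal :=
  ⨅ (r : ℝ) (_ : (((2 : ℝ) ^ r) • σ - ρ).PosSemidef), (r : EReal)

/-- Conditional min-entropy
`H_min(X|B)_ρ = log₂ N - inf_{τ} D_∞(ρ ‖ (1/N) I_X ⊗ τ)`, over density operators `τ` on `B`. -/
def condMinEntropy {N L : ℕ} (ρ : Matrix (Fin N × Fin L) (Fin N × Fin L) ℂ) : EReal :=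
  ((Real.logb 2 N : ℝ) : EReal) -
    ⨅ (τ : Matrix (Fin L) (Fin L) ℂ) (_ : IsDensity τ),
      relMinEntropy ρ ((N : ℝ)⁻¹ • ((1 : Matrix (Fin N) (Fin N) ℂ) ⊗ₖ τ))

/-! ### Quantum circuits -/

/-- Labels of the computational basis of `n` qubits. -/
abbrev Bits (n : ℕ) : Type := Fin n → Fin 2

/-- A gate: a number of qubits together with a unitary operator on that many qubits. -/
abbrev Gate : Type := Σ k : ℕ, Matrix.unitaryGroup (Bits k) ℂ

/-- A gate of the gate set `G`, placed on an ordered tuple of distinct wires out of `w` wires. -/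
structure PlacedGate (G : Set Gate) (w : ℕ) where
  gate : Gate
  mem : gate ∈ G
  wires : Fin gate.1 ↪ Fin w

open Classical in
/-- The operator of a placed gate: the gate on its wires, the identity on all the others. -/
def PlacedGate.toMatrix {G : Set Gate} {w : ℕ} (g : PlacedGate G w) :
    Matrix (Bits w) (Bits w) ℂ :=
  Matrix.of fun x y =>
    if ∀ j, j ∉ Set.range g.wires → x j = y j then
      (g.gate.2 : Matrix (Bits g.gate.1) (Bits g.gate.1) ℂ)
        (fun i => x (g.wires i)) (fun i => y (g.wires i))
    else 0

/-- A circuit over `G` on `w` wires is a finite sequence of placed gates; its size is its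
length. -/
abbrev Circuit (G : Set Gate) (w : ℕ) : Type := List (PlacedGate G w)

/-- The unitary `U₁ U₂ ⋯ U_s` of a circuit. -/
def Circuit.toMatrix {G : Set Gate} {w : ℕ} (C : Circuit G w) : Matrix (Bits w) (Bits w) ℂ :=
  (C.map PlacedGate.toMatrix).prod

/-- The isometry `|y⟩ ↦ |y⟩ ⊗ |0^a⟩` that appends `a` ancilla qubits in state `|0⟩`. -/
def appendZeros (n a : ℕ) : Matrix (Bits (n + a)) (Bits n) ℂ :=
  Matrix.of fun x y => if x = Fin.append y (fun _ => 0) then 1 else 0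

/-- Some circuit over `G`, using some number of ancilla qubits that start in `|0⟩` and are to be
returned to `|0⟩`, implements the operator `V` up to a global phase and an error of at most `η`
in the Euclidean norm on every computational basis state. -/
def ImplementsUpTo (G : Set Gate) {n : ℕ} (V : Matrix (Bits n) (Bits n) ℂ) (η : ℝ) : Prop :=
  ∃ (a : ℕ) (C : Circuit G (n + a)) (c : ℂ), ‖c‖ = 1 ∧
    ∀ y : Bits n,
      ∑ x : Bits (n + a),
        ‖(C.toMatrix * appendZeros n a - c • (appendZeros n a * V)) x y‖ ^ 2 ≤ η ^ 2

/-- The same without any error. -/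
def Implements (G : Set Gate) {n : ℕ} (V : Matrix (Bits n) (Bits n) ℂ) : Prop :=
  ∃ (a : ℕ) (C : Circuit G (n + a)) (c : ℂ), ‖c‖ = 1 ∧
    C.toMatrix * appendZeros n a = c • (appendZeros n a * V)

/-- A universal set of elementary gates: each gate acts on a bounded number of qubits, and every
unitary operator on any number of qubits is approximated arbitrarily well by circuits. -/
def IsUniversal (G : Set Gate) : Prop :=
  (∃ K : ℕ, ∀ g ∈ G, g.1 ≤ K) ∧
    ∀ (n : ℕ) (V : Matrix.unitaryGroup (Bits n) ℂ) (η : ℝ), 0 < η →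
      ImplementsUpTo G (V : Matrix (Bits n) (Bits n) ℂ) η

/-- The NOT gate `|x⟩ ↦ |x + 1⟩`. -/
def notGate : Matrix (Bits 1) (Bits 1) ℂ :=
  Matrix.of fun x y => if x 0 = y 0 + 1 then 1 else 0

/-- The Hadamard gate, with entries `(-1)^{xy}/√2`. -/
def hadamardGate : Matrix (Bits 1) (Bits 1) ℂ :=
  Matrix.of fun x y => (((Real.sqrt 2)⁻¹ : ℝ) : ℂ) * (-1) ^ ((x 0 : ℕ) * (y 0 : ℕ))

/-- The Toffoli gate `|u, v, t⟩ ↦ |u, v, t + uv⟩`. -/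
def toffoliGate : Matrix (Bits 3) (Bits 3) ℂ :=
  Matrix.of fun x y =>
    if x 0 = y 0 ∧ x 1 = y 1 ∧ x 2 = y 2 + y 0 * y 1 then 1 else 0

/-- The gate set implements the gates NOT, Hadamard and Toffoli without error. -/
def HasExactBasicGates (G : Set Gate) : Prop :=
  Implements G notGate ∧ Implements G hadamardGate ∧ Implements G toffoliGate

/-! ### Distinguishers -/

/-- A quantum distinguisher on `n` input qubits: some number of ancilla qubits (initially `|0⟩`)
and a circuit on all the wires, at the end of which the first wire is measured. -/
structure Distinguisher (G : Set Gate) (n : ℕ) where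
  ancillas : ℕ
  pos : 0 < n + ancillas
  circuit : Circuit G (n + ancillas)

/-- The size of a distinguisher is its number of gates. -/
def Distinguisher.size {G : Set Gate} {n : ℕ} (D : Distinguisher G n) : ℕ :=
  D.circuit.length

/-- The projector `|1⟩⟨1| ⊗ I` on the first of `w` wires. -/
def projFirstOne {w : ℕ} (hw : 0 < w) : Matrix (Bits w) (Bits w) ℂ :=
  Matrix.diagonal fun x => if x ⟨0, hw⟩ = 1 then 1 else 0

/-- The probability `⟨U (ρ ⊗ |0⟩⟨0|) U†, |1⟩⟨1| ⊗ I⟩` that `D` outputs `1` on the `n`-qubit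
state `ρ`. -/
def Distinguisher.prob {G : Set Gate} {n : ℕ} (D : Distinguisher G n)
    (ρ : Matrix (Bits n) (Bits n) ℂ) : ℝ :=
  (projFirstOne D.pos *
    (D.circuit.toMatrix *
      (appendZeros n D.ancillas * ρ * (appendZeros n D.ancillas).conjTranspose) *
      D.circuit.toMatrix.conjTranspose)).trace.re

/-- How the systems `X` (of dimension `N`) and `B` (of dimension `L`) are held in `m` and `l`
qubits: distinct basis states are labelled by distinct bit strings. If `N = 2^m` and `L = 2^l`,
this is just an identification of `X` and `B` with the spaces of `m` and `l` qubits. -/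
structure QubitEncoding (N L m l : ℕ) where
  encX : Fin N ↪ Bits m
  encB : Fin L ↪ Bits l

/-- The isometry `|x⟩ ⊗ |b⟩ ↦ |encX x⟩ ⊗ |encB b⟩`. -/
def QubitEncoding.toMatrix {N L m l : ℕ} (e : QubitEncoding N L m l) :
    Matrix (Bits (m + l)) (Fin N × Fin L) ℂ :=
  Matrix.of fun z p => if z = Fin.append (e.encX p.1) (e.encB p.2) then 1 else 0

/-- The probability (expected output) `𝔼[D(ρ_{XB})]`. -/
def accept {G : Set Gate} {N L m l : ℕ} (e : QubitEncoding N L m l)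
    (D : Distinguisher G (m + l)) (ρ : Matrix (Fin N × Fin L) (Fin N × Fin L) ℂ) : ℝ :=
  D.prob (e.toMatrix * ρ * e.toMatrix.conjTranspose)

/-- `(s, ε)`-quantum-indistinguishability. -/
def Indistinguishable (G : Set Gate) {N L m l : ℕ} (e : QubitEncoding N L m l) (s : ℕ) (ε : ℝ)
    (ρ σ : Matrix (Fin N × Fin L) (Fin N × Fin L) ℂ) : Prop :=
  ∀ D : Distinguisher G (m + l), D.size ≤ s → |accept e D ρ - accept e D σ| ≤ ε

/-! ### Pseudoentropies -/

/-- Relaxed HILL pseudoentropy: `H^{rHILL}_{s,ε}(X|B)_ρ ≥ k`. -/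
def RelaxedHILL (G : Set Gate) {N L m l : ℕ} (e : QubitEncoding N L m l) (s : ℕ) (ε k : ℝ)
    (ρ : Matrix (Fin N × Fin L) (Fin N × Fin L) ℂ) : Prop :=
  ∃ σ : Matrix (Fin N × Fin L) (Fin N × Fin L) ℂ, IsDensity σ ∧
    (k : EReal) ≤ condMinEntropy σ ∧ Indistinguishable G e s ε ρ σ

/-- HILL pseudoentropy: `H^{HILL}_{s,ε}(X|B)_ρ ≥ k`. -/
def HILL (G : Set Gate) {N L m l : ℕ} (e : QubitEncoding N L m l) (s : ℕ) (ε k : ℝ)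
    (ρ : Matrix (Fin N × Fin L) (Fin N × Fin L) ℂ) : Prop :=
  ∃ σ : Matrix (Fin N × Fin L) (Fin N × Fin L) ℂ, IsDensity σ ∧ traceX ρ = traceX σ ∧
    (k : EReal) ≤ condMinEntropy σ ∧ Indistinguishable G e s ε ρ σ

/-- Relaxed metric pseudoentropy: `H^{metric-rlx}_{s,ε}(X|B)_ρ ≥ k`. -/
def RelaxedMetric (G : Set Gate) {N L m l : ℕ} (e : QubitEncoding N L m l) (s : ℕ) (ε k : ℝ)
    (ρ : Matrix (Fin N × Fin L) (Fin N × Fin L) ℂ) : Prop :=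
  ∀ D : Distinguisher G (m + l), D.size ≤ s →
    ∃ σ : Matrix (Fin N × Fin L) (Fin N × Fin L) ℂ, IsDensity σ ∧
      (k : EReal) ≤ condMinEntropy σ ∧ |accept e D ρ - accept e D σ| < ε

/-- Metric pseudoentropy: `H^{metric}_{s,ε}(X|B)_ρ ≥ k`. -/
def Metric (G : Set Gate) {N L m l : ℕ} (e : QubitEncoding N L m l) (s : ℕ) (ε k : ℝ)
    (ρ : Matrix (Fin N × Fin L) (Fin N × Fin L) ℂ) : Prop :=
  ∀ D : Distinguisher G (m + l), D.size ≤ s →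
    ∃ σ : Matrix (Fin N × Fin L) (Fin N × Fin L) ℂ, IsDensity σ ∧ traceX ρ = traceX σ ∧
      (k : EReal) ≤ condMinEntropy σ ∧ |accept e D ρ - accept e D σ| < ε

end

end QuantumPseudoentropy

open scoped Kronecker ComplexOrder

namespace QuantumPseudoentropy

noncomputable section

set_option linter.unusedSectionVars false

/-! ### Operators placed on some of the wires -/

section Wires

variable {A B W : Type} [Fintype A] [DecidableEq A] [Fintype B] [DecidableEq B]
  [Fintype W] [DecidableEq W]

/-! The proof combines a minimax argument with sparse sampling. Let S be the convex set of
admissible states. If no state of S fools all distinguishers of size s', then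
`exists_forall_lt_or_exists_weights` gives a single probability distribution on signed
distinguishers whose mean advantage is at least ε + δ/2 against every state of S at once. To
contradict the metric hypothesis, this distribution must be replaced by one circuit of size s.

Sampling makes the distribution sparse. A signed distinguisher is an observable M with -1 ≤ M ≤ 1 on
a space of dimension NL. If the average of q sampled observables is close to the mean in operator
norm, it is close on all states simultaneously, so no union bound over S is needed.
`sumExpect_traceMoment_le` bounds the 2p-th trace moment of a sum of q independent centred matrices
by NL times a Gaussian moment. With p about log(NL), q = O(log(NL)/δ²) samples suffice
(`exists_sparse_average`).

The average of q circuits must then cost only O(q s') gates, although neither controlled gates nor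
inverses need be exactly available. `Sim.ctrl` controls a gate by conditionally swapping its wires
with a blank register. The resulting garbage depends on the control alone, so it never has to be
uncomputed. `Flagged.average` passes an activation flag to one of two channels according to a
Hadamard coin. Along a binary tree (`Flagged.uniform`) every circuit occurs once and every inner
node has constant cost, so no factor log q arises.

Since a gate set may be infinite, `exists_finite_net` replaces the distinguishers of size s' by
finitely many before the minimax theorem is used. -/

open Classical in
/-- The operator `V` on the wires in the range of `ι`, the identity on all the others. -/
def gateOp (ι : A ↪ W) (V : Matrix (A → Fin 2) (A → Fin 2) ℂ) :
    Matrix (W → Fin 2) (W → Fin 2) ℂ :=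
  Matrix.of fun x y =>
    if ∀ j, j ∉ Set.range ι → x j = y j then V (fun i => x (ι i)) (fun i => y (ι i)) else 0

open Classical in
theorem sum_agree (ι : A ↪ W) (x : W → Fin 2) (F : (W → Fin 2) → ℂ) :
    ∑ z, (if ∀ j, j ∉ Set.range ι → x j = z j then F z else 0) =
      ∑ a : A → Fin 2, F (Function.extend ι a x) := by
  refine (Finset.sum_filter (fun z : W → Fin 2 => ∀ j, j ∉ Set.range ι → x j = z j) F).symm.trans ?_
  symm
  refine Finset.sum_bij (fun a _ => Function.extend ι a x) ?_ ?_ ?_ ?_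
  · intro a _
    simp only [Finset.mem_filter, Finset.mem_univ, true_and]
    intro j hj
    rw [Function.extend_apply' _ _ _ hj]
  · intro a _ b _ h
    funext i
    simpa [ι.injective.extend_apply] using congrFun h (ι i)
  · intro z hz
    simp only [Finset.mem_filter, Finset.mem_univ, true_and] at hz
    refine ⟨fun i => z (ι i), Finset.mem_univ _, ?_⟩
    funext j
    by_cases hj : j ∈ Set.range ι
    · obtain ⟨i, rfl⟩ := hj
      rw [ι.injective.extend_apply]
    · rw [Function.extend_apply' _ _ _ hj, hz j hj]
  · intros; rfl

theorem gateOp_mul_apply {Y : Type} (ι : A ↪ W) (V : Matrix (A → Fin 2) (A → Fin 2) ℂ)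
    (M : Matrix (W → Fin 2) Y ℂ) (x : W → Fin 2) (y : Y) :
    (gateOp ι V * M) x y =
      ∑ a : A → Fin 2, V (fun i => x (ι i)) a * M (Function.extend ι a x) y := by
  classical
  simp only [Matrix.mul_apply, gateOp, Matrix.of_apply, ite_mul, zero_mul]
  rw [sum_agree ι x (fun z => V (fun i => x (ι i)) (fun i => z (ι i)) * M z y)]
  simp only [ι.injective.extend_apply]

theorem gateOp_mul (ι : A ↪ W) (V V' : Matrix (A → Fin 2) (A → Fin 2) ℂ) :
    gateOp ι (V * V') = gateOp ι V * gateOp ι V' := by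
  classical
  ext x y
  rw [gateOp_mul_apply]
  simp only [gateOp, Matrix.of_apply, ι.injective.extend_apply]
  have h : ∀ a : A → Fin 2, (∀ j, j ∉ Set.range ι → Function.extend ι a x j = y j) ↔
      ∀ j, j ∉ Set.range ι → x j = y j := fun a =>
    forall₂_congr fun j hj => by rw [Function.extend_apply' _ _ _ hj]
  simp only [h]
  split_ifs <;> simp [Matrix.mul_apply]

theorem gateOp_one (ι : A ↪ W) : gateOp ι 1 = (1 : Matrix (W → Fin 2) (W → Fin 2) ℂ) := by
  classical
  ext x y
  simp only [gateOp, Matrix.of_apply, Matrix.one_apply]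
  rw [← ite_and]
  congr 1
  rw [eq_iff_iff]
  constructor
  · rintro ⟨h1, h2⟩
    funext j
    by_cases hj : j ∈ Set.range ι
    · obtain ⟨i, rfl⟩ := hj
      exact congrFun h2 i
    · exact h1 j hj
  · rintro rfl
    simp

theorem gateOp_conjTranspose (ι : A ↪ W) (V : Matrix (A → Fin 2) (A → Fin 2) ℂ) :
    (gateOp ι V).conjTranspose = gateOp ι V.conjTranspose := by
  classical
  ext x y
  simp only [gateOp, Matrix.of_apply, Matrix.conjTranspose_apply, apply_ite star, star_zero]
  congr 1
  rw [eq_iff_iff]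
  exact forall₂_congr fun j _ => eq_comm

theorem gateOp_gateOp (κ : B ↪ A) (ι : A ↪ W) (V : Matrix (B → Fin 2) (B → Fin 2) ℂ) :
    gateOp ι (gateOp κ V) = gateOp (κ.trans ι) V := by
  classical
  ext x y
  simp only [gateOp, Matrix.of_apply, Function.Embedding.trans_apply]
  rw [← ite_and]
  congr 1
  rw [eq_iff_iff]
  constructor
  · rintro ⟨h1, h2⟩ j hj
    by_cases hj' : j ∈ Set.range ι
    · obtain ⟨i, rfl⟩ := hj'
      refine h2 i fun ⟨b, hb⟩ => hj ⟨b, by simp [hb]⟩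
    · exact h1 j hj'
  · intro h
    refine ⟨fun j hj => h j fun ⟨b, hb⟩ => hj ⟨κ b, hb⟩, fun i hi => h _ ?_⟩
    rintro ⟨b, hb⟩
    exact hi ⟨b, ι.injective hb⟩

theorem gateOp_isometry (ι : A ↪ W) {V : Matrix (A → Fin 2) (A → Fin 2) ℂ}
    (h : V.conjTranspose * V = 1) : (gateOp ι V).conjTranspose * gateOp ι V = 1 := by
  rw [gateOp_conjTranspose, ← gateOp_mul, h, gateOp_one]

theorem sum_sumElim (F : (A ⊕ B → Fin 2) → ℂ) :
    ∑ x, F x = ∑ a : A → Fin 2, ∑ b : B → Fin 2, F (Sum.elim a b) := by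
  rw [← Fintype.sum_prod_type',
    ← (Equiv.sumArrowEquivProdArrow A B (Fin 2)).symm.sum_comp]
  rfl

theorem sum_unitArrow (F : (Unit → Fin 2) → ℂ) :
    ∑ x, F x = F (fun _ => 0) + F (fun _ => 1) := by
  rw [← (Equiv.funUnique Unit (Fin 2)).symm.sum_comp, Fin.sum_univ_two]
  rfl

/-- The operator that permutes the computational basis, for `σ` an involution. -/
def permOp (σ : (W → Fin 2) → (W → Fin 2)) : Matrix (W → Fin 2) (W → Fin 2) ℂ :=
  Matrix.of fun x y => if y = σ x then 1 else 0

theorem permOp_mul_apply {Y : Type} (σ : (W → Fin 2) → (W → Fin 2))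
    (M : Matrix (W → Fin 2) Y ℂ) (x : W → Fin 2) (y : Y) :
    (permOp σ * M) x y = M (σ x) y := by
  simp [Matrix.mul_apply, permOp]

theorem permOp_mul_permOp (σ τ : (W → Fin 2) → (W → Fin 2)) :
    permOp σ * permOp τ = permOp (τ ∘ σ) := by
  ext x y
  rw [permOp_mul_apply]
  simp [permOp]

theorem mul_permOp_apply {Y : Type} [Fintype Y] {σ : (W → Fin 2) → (W → Fin 2)}
    (hσ : Function.Involutive σ) (M : Matrix Y (W → Fin 2) ℂ) (x : Y) (y : W → Fin 2) :
    (M * permOp σ) x y = M x (σ y) := by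
  have : ∀ z, y = σ z ↔ z = σ y := fun z => by rw [← hσ.eq_iff]; exact eq_comm
  simp [Matrix.mul_apply, permOp, this]

/-- `x_k ← x_k + x_i x_j`. -/
def toffoliMap (i j k : W) (x : W → Fin 2) : W → Fin 2 :=
  Function.update x k (x k + x i * x j)

/-- Three distinct wires. -/
def wires3 {i j k : W} (hij : i ≠ j) (hik : i ≠ k) (hjk : j ≠ k) : Fin 3 ↪ W where
  toFun := ![i, j, k]
  inj' := by
    intro a b h
    fin_cases a <;> fin_cases b <;> simp_all

theorem wires3_zero {i j k : W} (hij : i ≠ j) (hik : i ≠ k) (hjk : j ≠ k) :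
    wires3 hij hik hjk 0 = i := rfl

theorem wires3_one {i j k : W} (hij : i ≠ j) (hik : i ≠ k) (hjk : j ≠ k) :
    wires3 hij hik hjk 1 = j := rfl

theorem wires3_two {i j k : W} (hij : i ≠ j) (hik : i ≠ k) (hjk : j ≠ k) :
    wires3 hij hik hjk 2 = k := rfl

theorem mem_range_wires3 {i j k : W} (hij : i ≠ j) (hik : i ≠ k) (hjk : j ≠ k) (w : W) :
    w ∈ Set.range (wires3 hij hik hjk) ↔ w = i ∨ w = j ∨ w = k := by
  simp [Set.mem_range, Fin.exists_fin_succ, wires3_zero, wires3_one, wires3_two, eq_comm]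

theorem gateOp_toffoliGate {i j k : W} (hij : i ≠ j) (hik : i ≠ k) (hjk : j ≠ k) :
    gateOp (wires3 hij hik hjk) toffoliGate = permOp (toffoliMap i j k) := by
  classical
  ext x y
  simp only [gateOp, toffoliGate, permOp, Matrix.of_apply, wires3_zero, wires3_one, wires3_two,
    mem_range_wires3, not_or, and_imp]
  refine (ite_and _ _ _ _).symm.trans ?_
  congr 1
  rw [eq_iff_iff]
  have h2 : ∀ a b c : Fin 2, a = b + c ↔ b = a + c := by decide
  constructor
  · rintro ⟨h, h0, h1, h3⟩
    funext w
    by_cases hk : w = k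
    · subst hk
      rw [toffoliMap, Function.update_self, h0, h1]
      exact (h2 _ _ _).1 h3
    · rw [toffoliMap, Function.update_of_ne hk]
      by_cases hi : w = i
      · rw [hi, h0]
      by_cases hj : w = j
      · rw [hj, h1]
      exact (h w hi hj hk).symm
  · rintro rfl
    refine ⟨fun w _ _ hk => by rw [toffoliMap, Function.update_of_ne hk], ?_, ?_, ?_⟩
    · rw [toffoliMap, Function.update_of_ne hik]
    · rw [toffoliMap, Function.update_of_ne hjk]
    · rw [toffoliMap, Function.update_self, Function.update_of_ne hik,
        Function.update_of_ne hjk]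
      exact (h2 _ _ _).1 rfl

/-- One wire. -/
def wires1 (i : W) : Fin 1 ↪ W where
  toFun := fun _ => i
  inj' := fun _ _ _ => Subsingleton.elim _ _

theorem wires1_apply (i : W) (a : Fin 1) : wires1 i a = i := rfl

theorem mem_range_wires1 (i w : W) : w ∈ Set.range (wires1 i) ↔ w = i := by
  simp [Set.mem_range, wires1_apply, eq_comm]

theorem gateOp_notGate (i : W) :
    gateOp (wires1 i) notGate = permOp fun x => Function.update x i (x i + 1) := by
  classical
  ext x y
  simp only [gateOp, notGate, permOp, Matrix.of_apply, wires1_apply, mem_range_wires1]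
  refine (ite_and _ _ _ _).symm.trans ?_
  congr 1
  have h2 : ∀ a b : Fin 2, a = b + 1 ↔ b = a + 1 := by decide
  rw [eq_iff_iff]
  constructor
  · rintro ⟨h, h0⟩
    funext w
    by_cases hw : w = i
    · subst hw
      rw [Function.update_self]
      exact (h2 _ _).1 h0
    · rw [Function.update_of_ne hw, h w hw]
  · rintro rfl
    refine ⟨fun w hw => by rw [Function.update_of_ne hw], ?_⟩
    rw [Function.update_self]
    exact (h2 _ _).1 rfl

/-- Exchange of the bits `x_i` and `x_j` if `x_f = 1`. -/
def cswapMap (f i j : W) (x : W → Fin 2) : W → Fin 2 :=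
  if x f = 1 then x ∘ Equiv.swap i j else x

/-- A swap is three CNOTs; with f as an additional control on each, the CNOTs become Toffolis. -/
theorem cswapMap_eq {f i j : W} (hfi : f ≠ i) (hfj : f ≠ j) (hij : i ≠ j) :
    toffoliMap f i j ∘ toffoliMap f j i ∘ toffoliMap f i j = cswapMap f i j := by
  funext x w
  have h0 : ∀ a : Fin 2, a = 0 ∨ a = 1 := by decide
  have h2 : ∀ a b : Fin 2, a + (b + a) = b ∧ b + a + (a + (b + a)) = a ∧ a + b + a = b := by
    decide
  simp only [Function.comp, toffoliMap, cswapMap, Function.update_of_ne hfi,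
    Function.update_of_ne hfj, Function.update_of_ne hij, Function.update_of_ne hij.symm,
    Function.update_self]
  rcases h0 (x f) with hf | hf
  · rw [hf]
    by_cases hwj : w = j
    · subst hwj; simp
    · by_cases hwi : w = i
      · subst hwi; simp [hij]
      · simp [hwj]
  · rw [hf]
    by_cases hwj : w = j
    · subst hwj; simp [h2]
    · by_cases hwi : w = i
      · subst hwi; simp [h2, hij]
      · simp [hwi, hwj, Equiv.swap_apply_of_ne_of_ne hwi hwj]

end Wires

/-! ### Circuits with returned ancillas -/

section Circuits

variable {G : Set Gate} {A B W : Type} [Fintype A] [DecidableEq A] [Fintype B] [DecidableEq B]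
  [Fintype W] [DecidableEq W]

/-- `U` is the operator of a circuit over `G` with `s` gates, on wires labelled by `W`. -/
inductive IsCircuit (G : Set Gate) {W : Type} [Fintype W] [DecidableEq W] :
    ℕ → Matrix (W → Fin 2) (W → Fin 2) ℂ → Prop
  | nil : IsCircuit G 0 1
  | cons {s : ℕ} {U : Matrix (W → Fin 2) (W → Fin 2) ℂ} (g : Gate) (hg : g ∈ G)
      (ι : Fin g.1 ↪ W) (h : IsCircuit G s U) :
      IsCircuit G (s + 1) (gateOp ι (g.2 : Matrix (Bits g.1) (Bits g.1) ℂ) * U)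

theorem IsCircuit.mul {s t : ℕ} {U V : Matrix (W → Fin 2) (W → Fin 2) ℂ}
    (hU : IsCircuit G s U) (hV : IsCircuit G t V) : IsCircuit G (s + t) (U * V) := by
  induction hU with
  | nil => simpa using hV
  | cons g hg ι _ ih =>
    rw [add_right_comm, mul_assoc]
    exact .cons g hg ι ih

theorem IsCircuit.gateOp {s : ℕ} {U : Matrix (W → Fin 2) (W → Fin 2) ℂ}
    (hU : IsCircuit G s U) (ι : W ↪ A) : IsCircuit G s (gateOp ι U) := by
  induction hU with
  | nil => rw [gateOp_one]; exact .nil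
  | cons g hg κ _ ih =>
    rw [gateOp_mul, gateOp_gateOp]
    exact .cons g hg _ ih

theorem IsCircuit.isometry {s : ℕ} {U : Matrix (W → Fin 2) (W → Fin 2) ℂ}
    (hU : IsCircuit G s U) : U.conjTranspose * U = 1 := by
  induction hU with
  | nil => simp
  | @cons _ U g hg ι _ ih =>
    have h := gateOp_isometry ι (V := (g.2 : Matrix (Bits g.1) (Bits g.1) ℂ))
      (Matrix.mem_unitaryGroup_iff'.1 g.2.2)
    rw [Matrix.conjTranspose_mul, Matrix.mul_assoc, ← Matrix.mul_assoc _ _ U, h, Matrix.one_mul, ih]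

theorem PlacedGate.toMatrix_eq {w : ℕ} (g : PlacedGate G w) :
    g.toMatrix = gateOp g.wires (g.gate.2 : Matrix (Bits g.gate.1) (Bits g.gate.1) ℂ) := by
  ext x y
  simp only [PlacedGate.toMatrix, gateOp, Matrix.of_apply]
  congr

theorem Circuit.isCircuit {w : ℕ} (C : Circuit G w) : IsCircuit G C.length C.toMatrix := by
  induction C with
  | nil => exact .nil
  | cons g C ih =>
    have : Circuit.toMatrix (g :: C) = g.toMatrix * Circuit.toMatrix C := by
      simp [Circuit.toMatrix]
    rw [this, g.toMatrix_eq]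
    exact .cons g.gate g.mem g.wires ih

theorem IsCircuit.exists_circuit {w s : ℕ} {U : Matrix (Bits w) (Bits w) ℂ}
    (hU : IsCircuit G s U) : ∃ C : Circuit G w, C.length = s ∧ C.toMatrix = U := by
  induction hU with
  | nil => exact ⟨[], rfl, rfl⟩
  | cons g hg ι _ ih =>
    obtain ⟨C, rfl, rfl⟩ := ih
    refine ⟨⟨g, hg, ι⟩ :: C, rfl, ?_⟩
    simp [Circuit.toMatrix, PlacedGate.toMatrix_eq]

theorem gateOp_sumMap_apply {W' A' : Type} [Fintype W'] [DecidableEq W'] [Fintype A']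
    [DecidableEq A'] (ι : W ↪ W') (κ : A ↪ A')
    (U : Matrix (W ⊕ A → Fin 2) (W ⊕ A → Fin 2) ℂ) (x y : W' → Fin 2) (z z' : A' → Fin 2)
    [Decidable ((∀ w, w ∉ Set.range ι → x w = y w) ∧ ∀ a, a ∉ Set.range κ → z a = z' a)] :
    gateOp (ι.sumMap κ) U (Sum.elim x z) (Sum.elim y z') =
      if (∀ w, w ∉ Set.range ι → x w = y w) ∧ ∀ a, a ∉ Set.range κ → z a = z' a then
        U (Sum.elim (x ∘ ι) (z ∘ κ)) (Sum.elim (y ∘ ι) (z' ∘ κ)) else 0 := by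
  have e : ∀ (x : W' → Fin 2) (z : A' → Fin 2),
      (fun i => Sum.elim x z ((ι.sumMap κ) i)) = Sum.elim (x ∘ ι) (z ∘ κ) := fun x z => by
    funext i; cases i <;> rfl
  simp only [gateOp, Matrix.of_apply, e]
  congr 1
  simp [Sum.forall]

theorem sumElim_eq_iff {α β γ : Type} {a a' : α → γ} {b b' : β → γ} :
    Sum.elim a b = Sum.elim a' b' ↔ a = a' ∧ b = b' := by
  constructor
  · intro h
    exact ⟨funext fun i => congrFun h (.inl i), funext fun i => congrFun h (.inr i)⟩
  · rintro ⟨rfl, rfl⟩; rfl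

/-- The operator `V` is implemented by a circuit over `G` with at most `s` gates and with ancillas
that start in `|0⟩` and are returned to `|0⟩`, up to a global phase. -/
def Sim (G : Set Gate) (s : ℕ) (V : Matrix (W → Fin 2) (W → Fin 2) ℂ) : Prop :=
  ∃ (A : Type) (_ : Fintype A) (_ : DecidableEq A)
    (U : Matrix (W ⊕ A → Fin 2) (W ⊕ A → Fin 2) ℂ) (c : ℂ) (t : ℕ), t ≤ s ∧
    IsCircuit G t U ∧ ‖c‖ = 1 ∧
    ∀ x y z, U (Sum.elim x z) (Sum.elim y 0) = if z = 0 then c * V x y else 0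

theorem Sim.mono {s t : ℕ} {V : Matrix (W → Fin 2) (W → Fin 2) ℂ} (h : Sim G s V) (hst : s ≤ t) :
    Sim G t V := by
  obtain ⟨A, i1, i2, U, c, t', ht', h⟩ := h
  exact ⟨A, i1, i2, U, c, t', ht'.trans hst, h⟩

theorem Sim.gateOp {s : ℕ} {V : Matrix (W → Fin 2) (W → Fin 2) ℂ} (h : Sim G s V) (ι : W ↪ B) :
    Sim G s (gateOp ι V) := by
  classical
  obtain ⟨A, i1, i2, U, c, t, ht, hU, hc, h⟩ := h
  refine ⟨A, i1, i2, _, c, t, ht, hU.gateOp (ι.sumMap (.refl A)), hc, fun x y z => ?_⟩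
  rw [gateOp_sumMap_apply]
  simp only [Function.Embedding.coe_refl, Set.range_id, Set.mem_univ, not_true_eq_false,
    false_imp_iff, implies_true, and_true, Function.comp_id]
  rw [h]
  simp only [QuantumPseudoentropy.gateOp, Matrix.of_apply]
  split_ifs <;> first | rfl | simp

/-- A property of circuits that use ancillas `A` and return them to `|0⟩` persists if further
ancillas are added. -/
theorem returns_extend {A' : Type} [Fintype A'] [DecidableEq A'] (κ : A ↪ A')
    {U : Matrix (W ⊕ A → Fin 2) (W ⊕ A → Fin 2) ℂ} {V : Matrix (W → Fin 2) (W → Fin 2) ℂ}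
    (h : ∀ x y z, U (Sum.elim x z) (Sum.elim y 0) = if z = 0 then V x y else 0)
    (x y : W → Fin 2) (z : A' → Fin 2) :
    QuantumPseudoentropy.gateOp ((Function.Embedding.refl W).sumMap κ) U (Sum.elim x z)
      (Sum.elim y 0) = if z = 0 then V x y else 0 := by
  classical
  rw [gateOp_sumMap_apply]
  simp only [Function.Embedding.coe_refl, Set.range_id, Set.mem_univ, not_true_eq_false,
    false_imp_iff, implies_true, true_and, Function.comp_id]
  have : (0 : A' → Fin 2) ∘ κ = 0 := rfl
  rw [this, h, ← ite_and]
  congr 1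
  rw [eq_iff_iff]
  constructor
  · rintro ⟨h1, h2⟩
    funext a
    by_cases ha : a ∈ Set.range κ
    · obtain ⟨i, rfl⟩ := ha
      exact congrFun h2 i
    · exact h1 a ha
  · rintro rfl
    exact ⟨fun _ _ => rfl, rfl⟩

/-- The two circuits get disjoint ancilla registers. Each returns its register to zero exactly, so
the sum over intermediate ancilla values has a single surviving term. -/
theorem Sim.mul {s t : ℕ} {V V' : Matrix (W → Fin 2) (W → Fin 2) ℂ} (h : Sim G s V)
    (h' : Sim G t V') : Sim G (s + t) (V * V') := by
  obtain ⟨A, i1, i2, U, c, p, hp, hU, hc, h⟩ := h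
  obtain ⟨A', i1', i2', U', c', p', hp', hU', hc', h'⟩ := h'
  have e := returns_extend (.inl : A ↪ A ⊕ A') (V := c • V) (by simpa using h)
  have e' := returns_extend (.inr : A' ↪ A ⊕ A') (V := c' • V') (by simpa using h')
  refine ⟨A ⊕ A', inferInstance, inferInstance, _, c * c', p + p', by omega,
    (hU.gateOp ((Function.Embedding.refl W).sumMap .inl)).mul
      (hU'.gateOp ((Function.Embedding.refl W).sumMap .inr)), by rw [norm_mul, hc, hc', one_mul], fun x y z => ?_⟩
  rw [Matrix.mul_apply, sum_sumElim]
  simp only [e', mul_ite, mul_zero, Finset.sum_ite_eq', Finset.mem_univ, if_true, e, ite_mul,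
    zero_mul, Matrix.smul_apply, smul_eq_mul]
  split_ifs
  · rw [Matrix.mul_apply, Finset.mul_sum]
    exact Finset.sum_congr rfl fun _ _ => by ring
  · simp

theorem Sim.one : Sim G 0 (1 : Matrix (W → Fin 2) (W → Fin 2) ℂ) := by
  refine ⟨Empty, inferInstance, inferInstance, 1, 1, 0, le_rfl, .nil, by simp, fun x y z => ?_⟩
  have : z = 0 := Subsingleton.elim _ _
  simp [this, Matrix.one_apply, sumElim_eq_iff]

theorem Sim.of_mem {g : Gate} (hg : g ∈ G) :
    Sim G 1 (g.2 : Matrix (Bits g.1) (Bits g.1) ℂ) := by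
  classical
  refine ⟨Empty, inferInstance, inferInstance, _, 1, 1, le_rfl, .cons g hg .inl .nil, by simp,
    fun x y z => ?_⟩
  have : z = 0 := Subsingleton.elim _ _
  simp [this, QuantumPseudoentropy.gateOp]

/-- Up to the phase, V is a block of the isometry U, and the columns of U through that block vanish
outside it. -/
theorem Sim.isometry {s : ℕ} {V : Matrix (W → Fin 2) (W → Fin 2) ℂ} (h : Sim G s V) :
    V.conjTranspose * V = 1 := by
  obtain ⟨A, i1, i2, U, c, p, hp, hU, hc, h⟩ := h
  ext y y'
  have e := congrFun (congrFun hU.isometry (Sum.elim y 0)) (Sum.elim y' 0)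
  have hcc : star c * c = 1 := by
    rw [Complex.star_def, Complex.conj_mul', hc]; simp
  rw [Matrix.mul_apply, sum_sumElim, Matrix.one_apply] at e
  simp only [Matrix.conjTranspose_apply, h, apply_ite star, star_zero, mul_ite, mul_zero, ite_mul,
    zero_mul, Finset.sum_ite_eq', Finset.mem_univ, if_true, sumElim_eq_iff,
    and_true, star_mul'] at e
  rw [Matrix.one_apply, ← e, Matrix.mul_apply]
  refine Finset.sum_congr rfl fun x _ => ?_
  rw [Matrix.conjTranspose_apply]
  linear_combination (-(star (V x y) * V x y')) * hcc

theorem append_eq_append_iff {n a : ℕ} {x y : Bits n} {z z' : Bits a} :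
    Fin.append x z = Fin.append y z' ↔ x = y ∧ z = z' := by
  refine ⟨fun h => ⟨funext fun i => ?_, funext fun i => ?_⟩, fun h => by rw [h.1, h.2]⟩
  · simpa using congrFun h (Fin.castAdd a i)
  · simpa using congrFun h (Fin.natAdd n i)

theorem Implements.sim {n : ℕ} {V : Matrix (Bits n) (Bits n) ℂ} (h : Implements G V) :
    ∃ s, Sim G s V := by
  classical
  obtain ⟨a, C, c, hc, h⟩ := h
  refine ⟨C.length, Fin a, inferInstance, inferInstance, _, c, _, le_rfl,
    C.isCircuit.gateOp finSumFinEquiv.symm.toEmbedding, hc, fun x y z => ?_⟩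
  have e : ∀ (x : Bits n) (z : Bits a),
      (fun i => Sum.elim x z (finSumFinEquiv.symm.toEmbedding i)) = Fin.append x z :=
    fun x z => by
      funext i
      refine Fin.addCases (fun i => ?_) (fun i => ?_) i <;> simp
  simp only [QuantumPseudoentropy.gateOp, Matrix.of_apply, e]
  have h1 := congrFun (congrFun h (Fin.append x z)) y
  simp only [appendZeros, Matrix.mul_apply, Matrix.of_apply, mul_ite, mul_one, mul_zero,
    Finset.sum_ite_eq', Finset.mem_univ, if_true, Matrix.smul_apply, smul_eq_mul,
    ite_mul, one_mul, zero_mul] at h1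
  rw [if_pos (by simp)]
  refine h1.trans ?_
  have e2 : ∀ y' : Bits n, (Fin.append x z = Fin.append y' fun _ => 0) ↔ x = y' ∧ z = 0 :=
    fun y' => append_eq_append_iff
  simp only [e2, ite_and, Finset.sum_ite_eq, Finset.mem_univ, if_true]
  split_ifs <;> simp

end Circuits

/-! ### Controlled operators with garbage -/

section Control

variable {G : Set Gate} {A B W : Type} [Fintype A] [DecidableEq A] [Fintype B] [DecidableEq B]
  [Fintype W] [DecidableEq W]

theorem sumElim_zero : (0 : A ⊕ B → Fin 2) = Sum.elim (0 : A → Fin 2) (0 : B → Fin 2) := by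
  funext j; cases j <;> rfl

theorem Sim.toffoli {t : ℕ} (hT : Sim G t toffoliGate) {i j k : W} (hij : i ≠ j) (hik : i ≠ k)
    (hjk : j ≠ k) : Sim G t (permOp (toffoliMap i j k)) := by
  rw [← gateOp_toffoliGate hij hik hjk]
  exact hT.gateOp _

theorem Sim.cswap {t : ℕ} (hT : Sim G t toffoliGate) {f i j : W} (hfi : f ≠ i) (hfj : f ≠ j)
    (hij : i ≠ j) : Sim G (3 * t) (permOp (cswapMap f i j)) := by
  rw [← cswapMap_eq hfi hfj hij, ← permOp_mul_permOp, ← permOp_mul_permOp]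
  exact (((hT.toffoli hfi hfj hij).mul (hT.toffoli hfj hfi hij.symm)).mul
    (hT.toffoli hfi hfj hij)).mono (by omega)

/-- If the control bit is `1`, exchange the bits in `S` with their copies. -/
def exchangeMap (S : Finset W) (x : W ⊕ (Unit ⊕ W) → Fin 2) : W ⊕ (Unit ⊕ W) → Fin 2
  | .inl w => if x (.inr (.inl ())) = 1 ∧ w ∈ S then x (.inr (.inr w)) else x (.inl w)
  | .inr (.inl u) => x (.inr (.inl u))
  | .inr (.inr w) => if x (.inr (.inl ())) = 1 ∧ w ∈ S then x (.inl w) else x (.inr (.inr w))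

theorem exchangeMap_involutive (S : Finset W) : Function.Involutive (exchangeMap S) := by
  intro x
  funext j
  rcases j with w | u | w
  · by_cases h : x (.inr (.inl ())) = 1 ∧ w ∈ S <;> simp [exchangeMap, h]
  · rfl
  · by_cases h : x (.inr (.inl ())) = 1 ∧ w ∈ S <;> simp [exchangeMap, h]

theorem exchangeMap_insert (S : Finset W) {a : W} (ha : a ∉ S) :
    exchangeMap (insert a S) =
      cswapMap (.inr (.inl ())) (.inl a) (.inr (.inr a)) ∘ exchangeMap S := by
  funext x j
  simp only [Function.comp, cswapMap]
  have hf : exchangeMap S x (.inr (.inl ())) = x (.inr (.inl ())) := rfl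
  rw [hf]
  by_cases h : x (.inr (.inl ())) = 1
  · rw [if_pos h]
    rcases j with w | u | w
    · by_cases hw : w = a
      · subst hw
        simp [exchangeMap, h, ha]
      · rw [Function.comp, Equiv.swap_apply_of_ne_of_ne (by simpa using hw) (by simp)]
        simp [exchangeMap, hw]
    · rw [Function.comp, Equiv.swap_apply_of_ne_of_ne (by simp) (by simp)]
      rfl
    · by_cases hw : w = a
      · subst hw
        simp [exchangeMap, h, ha]
      · rw [Function.comp, Equiv.swap_apply_of_ne_of_ne (by simp) (by simpa using hw)]
        simp [exchangeMap, hw]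
  · rw [if_neg h]
    rcases j with w | u | w <;> simp [exchangeMap, h]

/-- One controlled swap, hence three Toffolis, for each element of S. -/
theorem Sim.exchange {t : ℕ} (hT : Sim G t toffoliGate) (S : Finset W) :
    Sim G (3 * t * S.card) (permOp (exchangeMap S)) := by
  induction S using Finset.induction_on with
  | empty =>
    have : permOp (exchangeMap (∅ : Finset W)) = 1 := by
      ext x y
      have : exchangeMap (∅ : Finset W) x = x := by
        funext j
        rcases j with w | u | w <;> simp [exchangeMap]
      simp [permOp, Matrix.one_apply, this, eq_comm]
    rw [this]
    exact Sim.one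
  | insert a S ha ih =>
    rw [exchangeMap_insert S ha, ← permOp_mul_permOp]
    refine (ih.mul (hT.cswap (by simp) (by simp) (by simp))).mono ?_
    rw [Finset.card_insert_of_notMem ha]
    exact le_of_eq (by ring)

theorem exchangeMap_univ_zero (x z : W → Fin 2) :
    exchangeMap Finset.univ (Sum.elim x (Sum.elim (fun _ => 0) z)) =
      Sum.elim x (Sum.elim (fun _ => 0) z) := by
  funext j
  rcases j with w | u | w <;> simp [exchangeMap]

theorem exchangeMap_univ_one (x z : W → Fin 2) :
    exchangeMap Finset.univ (Sum.elim x (Sum.elim (fun _ => 1) z)) =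
      Sum.elim z (Sum.elim (fun _ => 1) x) := by
  funext j
  rcases j with w | u | w <;> simp [exchangeMap]

/-- `V` can be applied under the control of a qubit, at the cost of `s` gates and of garbage that
depends on nothing but the control. -/
def Ctrl (G : Set Gate) (s : ℕ) (V : Matrix (W → Fin 2) (W → Fin 2) ℂ) : Prop :=
  ∃ (A : Type) (_ : Fintype A) (_ : DecidableEq A)
    (U : Matrix (W ⊕ (Unit ⊕ A) → Fin 2) (W ⊕ (Unit ⊕ A) → Fin 2) ℂ)
    (g : Fin 2 → (A → Fin 2) → ℂ), Sim G s U ∧ (∀ b, ∑ z, star (g b z) * g b z = 1) ∧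
    ∀ x y b b' z, U (Sum.elim x (Sum.elim (fun _ => b') z)) (Sum.elim y (Sum.elim (fun _ => b) 0)) =
      if b' = b then (if b = 1 then V else 1) x y * g b z else 0

theorem Ctrl.mono {s t : ℕ} {V : Matrix (W → Fin 2) (W → Fin 2) ℂ} (h : Ctrl G s V)
    (hst : s ≤ t) : Ctrl G t V := by
  obtain ⟨A, i1, i2, U, g, hU, h⟩ := h
  exact ⟨A, i1, i2, U, g, hU.mono hst, h⟩

theorem Ctrl.one : Ctrl G 0 (1 : Matrix (W → Fin 2) (W → Fin 2) ℂ) := by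
  refine ⟨Empty, inferInstance, inferInstance, 1, fun _ _ => 1, .one, by simp, fun x y b b' z => ?_⟩
  have : z = 0 := Subsingleton.elim _ _
  subst this
  simp only [Matrix.one_apply, sumElim_eq_iff, and_true, ite_self, mul_one]
  by_cases hb : b' = b
  · simp [hb]
  · have : (fun _ : Unit => b') ≠ fun _ => b := fun h => hb (congrFun h ())
    simp [hb, this]

/-- V always acts on a second, initially blank register. Conditional exchanges before and after
place the data there exactly when the control is 1. Only V itself is used, neither its inverse nor a
controlled version of it. The cost is two exchanges of 3t gates per wire. -/
theorem Sim.ctrl {s t : ℕ} (hT : Sim G t toffoliGate) {V : Matrix (W → Fin 2) (W → Fin 2) ℂ}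
    (hV : Sim G s V) : Ctrl G (s + 6 * t * Fintype.card W) V := by
  classical
  have hE := hT.exchange (Finset.univ : Finset W)
  let κ : W ↪ W ⊕ (Unit ⊕ W) := Function.Embedding.inr.trans .inr
  have happ : ∀ x y z z' : W → Fin 2, ∀ b b' : Fin 2,
      QuantumPseudoentropy.gateOp κ V (Sum.elim x (Sum.elim (fun _ => b') z))
        (Sum.elim y (Sum.elim (fun _ => b) z')) =
      if b' = b ∧ x = y then V z z' else 0 := by
    intro x y z z' b b'
    simp only [QuantumPseudoentropy.gateOp, Matrix.of_apply]
    congr 1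
    simp [κ, Sum.forall, funext_iff, and_comm]
  refine ⟨W, inferInstance, inferInstance,
    permOp (exchangeMap Finset.univ) * QuantumPseudoentropy.gateOp κ V *
      permOp (exchangeMap Finset.univ),
    -- With control 1 the blank register comes back blank; with control 0 it has been turned into
    -- V|0⟩.
    fun b z => if b = 1 then (if z = 0 then 1 else 0) else V z 0,
    ((hE.mul (hV.gateOp κ)).mul hE).mono (le_of_eq (by rw [Finset.card_univ]; ring)), ?_, ?_⟩
  · have h0 : ∀ b : Fin 2, b = 0 ∨ b = 1 := by decide
    intro b
    rcases h0 b with rfl | rfl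
    · have := congrFun (congrFun hV.isometry 0) 0
      simpa [Matrix.mul_apply] using this
    · simp
  · intro x y b b' z
    rw [mul_permOp_apply (exchangeMap_involutive _), permOp_mul_apply]
    have h0 : ∀ b : Fin 2, b = 0 ∨ b = 1 := by decide
    rcases h0 b with rfl | rfl <;> rcases h0 b' with rfl | rfl <;>
      simp only [exchangeMap_univ_zero, exchangeMap_univ_one, happ]
    · simp [Matrix.one_apply]
    · simp
    · simp
    · simp

theorem Ctrl.gateOp {s : ℕ} {V : Matrix (W → Fin 2) (W → Fin 2) ℂ} (h : Ctrl G s V) (ι : W ↪ B) :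
    Ctrl G s (gateOp ι V) := by
  classical
  obtain ⟨A, i1, i2, U, g, hU, hg, h⟩ := h
  refine ⟨A, i1, i2, _, g, hU.gateOp (ι.sumMap (.refl (Unit ⊕ A))), hg, fun x y b b' z => ?_⟩
  rw [gateOp_sumMap_apply]
  simp only [Function.Embedding.coe_refl, Set.range_id, Set.mem_univ, not_true_eq_false,
    false_imp_iff, implies_true, and_true, Function.comp_id]
  rw [h]
  by_cases hb : b' = b
  · rw [if_pos hb, if_pos hb]
    by_cases h1 : b = 1
    · simp only [if_pos h1, QuantumPseudoentropy.gateOp, Matrix.of_apply]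
      split_ifs
      · rfl
      · simp
    · simp only [if_neg h1]
      rw [← gateOp_one ι]
      simp only [QuantumPseudoentropy.gateOp, Matrix.of_apply]
      split_ifs
      · rfl
      · simp
  · simp [hb]

/-- The control is shared and the garbage registers are separate. The garbage amplitudes multiply
and still do not depend on the data. -/
theorem Ctrl.mul {s t : ℕ} {V V' : Matrix (W → Fin 2) (W → Fin 2) ℂ} (h : Ctrl G s V)
    (h' : Ctrl G t V') : Ctrl G (s + t) (V * V') := by
  classical
  obtain ⟨A, i1, i2, U, g, hU, hg, h⟩ := h
  obtain ⟨A', i1', i2', U', g', hU', hg', h'⟩ := h'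
  let κ : Unit ⊕ A ↪ Unit ⊕ (A ⊕ A') := (Function.Embedding.refl Unit).sumMap .inl
  let κ' : Unit ⊕ A' ↪ Unit ⊕ (A ⊕ A') := (Function.Embedding.refl Unit).sumMap .inr
  have e : ∀ (x y : W → Fin 2) (v v' : Unit → Fin 2) (z w : A → Fin 2) (z' w' : A' → Fin 2),
      QuantumPseudoentropy.gateOp ((Function.Embedding.refl W).sumMap κ) U
        (Sum.elim x (Sum.elim v (Sum.elim z z'))) (Sum.elim y (Sum.elim v' (Sum.elim w w'))) =
      if z' = w' then U (Sum.elim x (Sum.elim v z)) (Sum.elim y (Sum.elim v' w)) else 0 := by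
    intro x y v v' z w z' w'
    rw [gateOp_sumMap_apply]
    have : ∀ (v : Unit → Fin 2) (z : A → Fin 2) (z' : A' → Fin 2),
        Sum.elim v (Sum.elim z z') ∘ κ = Sum.elim v z := fun v z z' => by
      funext j; cases j <;> rfl
    rw [this, this]
    refine if_congr ?_ rfl rfl
    simp [κ, Sum.forall, funext_iff]
  have e' : ∀ (x y : W → Fin 2) (v v' : Unit → Fin 2) (z w : A → Fin 2) (z' w' : A' → Fin 2),
      QuantumPseudoentropy.gateOp ((Function.Embedding.refl W).sumMap κ') U'
        (Sum.elim x (Sum.elim v (Sum.elim z z'))) (Sum.elim y (Sum.elim v' (Sum.elim w w'))) =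
      if z = w then U' (Sum.elim x (Sum.elim v z')) (Sum.elim y (Sum.elim v' w')) else 0 := by
    intro x y v v' z w z' w'
    rw [gateOp_sumMap_apply]
    have : ∀ (v : Unit → Fin 2) (z : A → Fin 2) (z' : A' → Fin 2),
        Sum.elim v (Sum.elim z z') ∘ κ' = Sum.elim v z' := fun v z z' => by
      funext j; cases j <;> rfl
    rw [this, this]
    refine if_congr ?_ rfl rfl
    simp [κ', Sum.forall, funext_iff]
  refine ⟨A ⊕ A', inferInstance, inferInstance,
    QuantumPseudoentropy.gateOp ((Function.Embedding.refl W).sumMap κ) U *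
      QuantumPseudoentropy.gateOp ((Function.Embedding.refl W).sumMap κ') U',
    fun b z => g b (z ∘ .inl) * g' b (z ∘ .inr), (hU.gateOp _).mul (hU'.gateOp _), ?_, ?_⟩
  · intro b
    rw [sum_sumElim, ← one_mul (1 : ℂ)]
    nth_rewrite 1 [← hg b]
    rw [← hg' b, Finset.sum_mul_sum]
    refine Finset.sum_congr rfl fun z _ => Finset.sum_congr rfl fun z' _ => ?_
    simp only [Sum.elim_comp_inl, Sum.elim_comp_inr, star_mul']
    ring
  · intro x y b b' z
    obtain ⟨z, z', rfl⟩ : ∃ (u : A → Fin 2) (u' : A' → Fin 2), z = Sum.elim u u' :=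
      ⟨z ∘ .inl, z ∘ .inr, (Sum.elim_comp_inl_inr z).symm⟩
    rw [sumElim_zero, Matrix.mul_apply]
    simp only [sum_sumElim, e, e', sum_unitArrow]
    have h0 : ∀ b : Fin 2, b = 0 ∨ b = 1 := by decide
    rcases h0 b with rfl | rfl <;> rcases h0 b' with rfl | rfl <;>
      simp [h, h', Matrix.one_apply, Matrix.mul_apply, Finset.mul_sum, mul_assoc, mul_left_comm, mul_comm]

/-- The control is applied gate by gate, so each exchange involves at most K wires. Exchanging all
wires of the circuit would cost an amount proportional to their number instead of a constant factor.
-/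
theorem IsCircuit.ctrl {s t K : ℕ} (hT : Sim G t toffoliGate) (hK : ∀ g ∈ G, g.1 ≤ K)
    {V : Matrix (W → Fin 2) (W → Fin 2) ℂ} (hV : IsCircuit G s V) :
    Ctrl G (s * (1 + 6 * t * K)) V := by
  induction hV with
  | nil => simpa using Ctrl.one
  | cons g hg ι _ ih =>
    refine (((hT.ctrl (Sim.of_mem hg)).gateOp ι).mul ih).mono ?_
    have : 6 * t * Fintype.card (Fin g.1) ≤ 6 * t * K :=
      Nat.mul_le_mul_left _ (by simpa using hK g hg)
    linarith [add_one_mul ‹ℕ› (1 + 6 * t * K)]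

end Control

/-! ### Uniform mixtures of circuits -/

section Mixture

variable {G : Set Gate} {A B W : Type} [Fintype A] [DecidableEq A] [Fintype B] [DecidableEq B]
  [Fintype W] [DecidableEq W]

/-- The kernel `V ⊗ V̄` of the channel of an operator `V`. -/
def channelKernel (V : Matrix (W → Fin 2) (W → Fin 2) ℂ) (x y x' y' : W → Fin 2) : ℂ :=
  V x y * star (V x' y')

/-- The channel with kernel `K` can be applied under the control of a qubit. With control `0` the
wires in `W` are left alone. -/
def Flagged (G : Set Gate) (s : ℕ)
    (K : (W → Fin 2) → (W → Fin 2) → (W → Fin 2) → (W → Fin 2) → ℂ) : Prop :=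
  ∃ (R : Type) (_ : Fintype R) (_ : DecidableEq R) (f : R)
    (U : Matrix (W ⊕ R → Fin 2) (W ⊕ R → Fin 2) ℂ) (g : (R → Fin 2) → ℂ), Sim G s U ∧
    ∑ z, g z * star (g z) = 1 ∧
    (∀ x y z, U (Sum.elim x z) (Sum.elim y 0) = if x = y then g z else 0) ∧
    ∀ x y x' y', ∑ z, U (Sum.elim x z) (Sum.elim y (Pi.single f 1)) *
      star (U (Sum.elim x' z) (Sum.elim y' (Pi.single f 1))) = K x y x' y'

theorem Flagged.mono {s t : ℕ} {K : (W → Fin 2) → (W → Fin 2) → (W → Fin 2) → (W → Fin 2) → ℂ}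
    (h : Flagged G s K) (hst : s ≤ t) : Flagged G t K := by
  obtain ⟨R, i1, i2, f, U, g, hU, h⟩ := h
  exact ⟨R, i1, i2, f, U, g, hU.mono hst, h⟩

theorem Ctrl.flagged {s : ℕ} {V : Matrix (W → Fin 2) (W → Fin 2) ℂ} (h : Ctrl G s V) :
    Flagged G s (channelKernel V) := by
  obtain ⟨A, i1, i2, U, g, hU, hg, h⟩ := h
  have e0 : (0 : Unit ⊕ A → Fin 2) = Sum.elim (fun _ => 0) 0 := sumElim_zero
  have e1 : (Pi.single (.inl ()) 1 : Unit ⊕ A → Fin 2) = Sum.elim (fun _ => 1) 0 := by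
    funext j; rcases j with ⟨⟩ | j <;> simp
  refine ⟨Unit ⊕ A, inferInstance, inferInstance, .inl (), U,
    fun z => if z (.inl ()) = 0 then g 0 (z ∘ .inr) else 0, hU, ?_, fun x y z => ?_,
    fun x y x' y' => ?_⟩
  · rw [sum_sumElim, sum_unitArrow, ← hg 0]
    simp only [Sum.elim_inl, if_true, Sum.elim_comp_inr, one_ne_zero, if_false, zero_mul,
      Finset.sum_const_zero, add_zero]
    exact Finset.sum_congr rfl fun _ _ => mul_comm _ _
  · obtain ⟨b, z, rfl⟩ : ∃ (b : Fin 2) (u : A → Fin 2), z = Sum.elim (fun _ => b) u :=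
      ⟨z (.inl ()), z ∘ .inr, by funext j; rcases j with ⟨⟩ | j <;> rfl⟩
    rw [e0, h]
    have h0 : ∀ b : Fin 2, b = 0 ∨ b = 1 := by decide
    rcases h0 b with rfl | rfl <;> simp [Matrix.one_apply]
  · rw [e1, sum_sumElim, sum_unitArrow]
    simp only [h, zero_ne_one, if_false, if_true, zero_mul, Finset.sum_const_zero, zero_add,
      star_mul']
    have := congrArg (V x y * star (V x' y') * ·) (hg 1)
    simp only [mul_one, Finset.mul_sum] at this
    rw [channelKernel, ← this]
    exact Finset.sum_congr rfl fun _ _ => by ring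

theorem sum_mul_gateOp_hadamard (r : W) (F : (W → Fin 2) → ℂ) {y : W → Fin 2} (hy : y r = 0) :
    ∑ w, F w * gateOp (wires1 r) hadamardGate w y =
      (((Real.sqrt 2)⁻¹ : ℝ) : ℂ) * (F y + F (Function.update y r 1)) := by
  classical
  have e : ∀ w, F w * gateOp (wires1 r) hadamardGate w y =
      if ∀ j, j ∉ Set.range (wires1 r) → y j = w j then (((Real.sqrt 2)⁻¹ : ℝ) : ℂ) * F w else 0 := by
    intro w
    simp only [gateOp, hadamardGate, Matrix.of_apply, wires1_apply, hy]
    simp only [@eq_comm _ (w _)]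
    split_ifs
    · simp [mul_comm]
    · simp
  simp only [e]
  rw [sum_agree (wires1 r) y (fun w => (((Real.sqrt 2)⁻¹ : ℝ) : ℂ) * F w)]
  have e2 : ∀ c : Fin 2, Function.extend (wires1 r) (fun _ => c) y = Function.update y r c := by
    intro c
    funext j
    by_cases hj : j = r
    · subst hj
      rw [Function.update_self]
      exact (wires1 j).injective.extend_apply _ _ 0
    · rw [Function.update_of_ne hj, Function.extend_apply']
      exact fun h => hj ((mem_range_wires1 r j).1 h)
  rw [← (Equiv.funUnique (Fin 1) (Fin 2)).symm.sum_comp, Fin.sum_univ_two]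
  have e3 : ∀ c : Fin 2, (Equiv.funUnique (Fin 1) (Fin 2)).symm c = fun _ => c := fun _ => rfl
  rw [e3, e3, e2, e2, mul_add]
  rw [show Function.update y r 0 = y from Function.update_eq_self_iff.2 hy.symm]

theorem toffoliMap_involutive {i j k : W} (hik : i ≠ k) (hjk : j ≠ k) :
    Function.Involutive (toffoliMap i j k) := by
  intro x
  have h2 : ∀ a b : Fin 2, a + b + b = a := by decide
  funext w
  by_cases hw : w = k
  · subst hw
    simp [toffoliMap, Function.update_of_ne hik, Function.update_of_ne hjk, h2]
  · simp [toffoliMap, hw]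

theorem toffoliMap_eq_self {i j k : W} {x : W → Fin 2} (h : x i * x j = 0) :
    toffoliMap i j k x = x := by
  rw [toffoliMap, h, add_zero, Function.update_eq_self]

/-- A Hadamard coin decides which of the two channels receives the flag. The coin is left in place
and traced out, so the two branches do not interfere and the kernels are averaged. With flag 0
neither channel is activated, whatever the coin. -/
theorem Flagged.average {s s' t h : ℕ} (hT : Sim G t toffoliGate) (hH : Sim G h hadamardGate)
    {K K' : (W → Fin 2) → (W → Fin 2) → (W → Fin 2) → (W → Fin 2) → ℂ}
    (hK : Flagged G s K) (hK' : Flagged G s' K') :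
    Flagged G (s + s' + (h + 2 * t)) fun x y x' y' => (K x y x' y' + K' x y x' y') / 2 := by
  classical
  obtain ⟨R, i1, i2, f, U, g, hU, hg, hU0, hU1⟩ := hK
  obtain ⟨R', i1', i2', l, U', g', hU', hg', hU0', hU1'⟩ := hK'
  let κ : R ↪ (R ⊕ R') ⊕ Unit := Function.Embedding.inl.trans .inl
  let κ' : R' ↪ (R ⊕ R') ⊕ Unit := Function.Embedding.inr.trans .inl
  let F : W ⊕ ((R ⊕ R') ⊕ Unit) := .inr (.inl (.inl f))
  let L : W ⊕ ((R ⊕ R') ⊕ Unit) := .inr (.inl (.inr l))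
  let C : W ⊕ ((R ⊕ R') ⊕ Unit) := .inr (.inr ())
  have hFL : F ≠ L := by simp [F, L]
  have hFC : F ≠ C := by simp [F, C]
  have hLC : L ≠ C := by simp [L, C]
  let E := gateOp ((Function.Embedding.refl W).sumMap κ) U
  let E' := gateOp ((Function.Embedding.refl W).sumMap κ') U'
  let c : ℂ := (((Real.sqrt 2)⁻¹ : ℝ) : ℂ)
  have hc : c * star c = 1 / 2 := by
    simp only [c, Complex.star_def, Complex.conj_ofReal]
    rw [← Complex.ofReal_mul, ← mul_inv, Real.mul_self_sqrt (by norm_num)]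
    norm_num
  have e : ∀ (x y : W → Fin 2) (p q : R → Fin 2) (p' q' : R' → Fin 2) (r v : Unit → Fin 2),
      E (Sum.elim x (Sum.elim (Sum.elim p p') r)) (Sum.elim y (Sum.elim (Sum.elim q q') v)) =
      if p' = q' ∧ r = v then U (Sum.elim x p) (Sum.elim y q) else 0 := by
    intro x y p q p' q' r v
    simp only [E]
    rw [gateOp_sumMap_apply]
    refine if_congr ?_ rfl rfl
    simp [κ, Sum.forall, funext_iff]
  have e' : ∀ (x y : W → Fin 2) (p q : R → Fin 2) (p' q' : R' → Fin 2) (r v : Unit → Fin 2),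
      E' (Sum.elim x (Sum.elim (Sum.elim p p') r)) (Sum.elim y (Sum.elim (Sum.elim q q') v)) =
      if p = q ∧ r = v then U' (Sum.elim x p') (Sum.elim y q') else 0 := by
    intro x y p q p' q' r v
    simp only [E']
    rw [gateOp_sumMap_apply]
    refine if_congr ?_ rfl rfl
    simp [κ', Sum.forall, funext_iff]
  -- the two selected operators, on a column without garbage
  have hEE : ∀ (x y : W → Fin 2) (p q : R → Fin 2) (p' q' : R' → Fin 2) (r v : Unit → Fin 2),
      (E' * E) (Sum.elim x (Sum.elim (Sum.elim p p') r))
        (Sum.elim y (Sum.elim (Sum.elim q q') v)) =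
      if r = v then ∑ w, U' (Sum.elim x p') (Sum.elim w q') * U (Sum.elim w p) (Sum.elim y q)
      else 0 := by
    intro x y p q p' q' r v
    rw [Matrix.mul_apply]
    simp only [sum_sumElim (A := W), sum_sumElim (A := R ⊕ R'), sum_sumElim (A := R), e, e',
      ite_and, mul_ite, ite_mul, zero_mul, mul_zero, Finset.sum_ite_eq, Finset.sum_ite_eq',
      Finset.mem_univ, if_true, Finset.sum_ite_irrel, Finset.sum_const_zero]
  -- Read from right to left: toss the coin C; copy the flag F to L if C = 1; clear F if L = C = 1;
  -- run both channels, of which at most one is active. Thus F = 1 becomes F = 1, L = 0 or F = 0, L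
  -- = 1.
  let T := E' * E * (permOp (toffoliMap L C F) * permOp (toffoliMap F C L) *
    gateOp (wires1 C) hadamardGate)
  have hTcol : ∀ (w : W ⊕ ((R ⊕ R') ⊕ Unit) → Fin 2) (y : W → Fin 2) (b : Fin 2),
      T w (Sum.elim y (Pi.single (.inl (.inl f)) b)) =
      c * ((E' * E) w (Sum.elim y (Sum.elim (Sum.elim (Pi.single f b) 0) fun _ => 0)) +
        (E' * E) w (Sum.elim y (Sum.elim (Sum.elim 0 (Pi.single l b)) fun _ => 1))) := by
    intro w y b
    have h0 : ∀ b : Fin 2, b = 0 ∨ b = 1 := by decide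
    simp only [T]
    rw [← mul_assoc, ← mul_assoc, Matrix.mul_apply, sum_mul_gateOp_hadamard _ _ (by simp [C]),
      mul_permOp_apply (toffoliMap_involutive hFL hLC.symm),
      mul_permOp_apply (toffoliMap_involutive hFL hLC.symm),
      mul_permOp_apply (toffoliMap_involutive hFL.symm hFC.symm),
      mul_permOp_apply (toffoliMap_involutive hFL.symm hFC.symm)]
    congr 3
    · rw [toffoliMap_eq_self (i := F) (by simp [C]), toffoliMap_eq_self (by simp [L])]
      refine congrArg ((E' * E) w) (funext fun j => ?_)
      rcases j with j | (j | j) | j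
      · rfl
      · simp only [Sum.elim_inr, Sum.elim_inl, Pi.single_apply, Sum.inl.injEq]
      · simp
      · simp
    · rcases h0 b with rfl | rfl
      · rw [toffoliMap_eq_self (i := F) (by simp [F, C]),
          toffoliMap_eq_self (by simp [L, C])]
        refine congrArg ((E' * E) w) (funext fun j => ?_)
        rw [Pi.single_zero, Pi.single_zero]
        by_cases hj : j = C
        · subst hj
          rw [Function.update_self]
          rfl
        · rw [Function.update_of_ne hj]
          rcases j with j | (j | j) | j
          · rfl
          · rfl
          · rfl
          · exact absurd rfl hj
      · have e1 : toffoliMap F C L (Function.update (Sum.elim y (Pi.single (.inl (.inl f)) 1)) C 1) =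
            Sum.elim y (Sum.elim (Sum.elim (Pi.single f 1) (Pi.single l 1)) fun _ => 1) := by
          funext j
          by_cases hj : j = L
          · subst hj
            rw [toffoliMap, Function.update_self, Function.update_of_ne hLC,
              Function.update_of_ne hFC, Function.update_self]
            simp [L, F]
          · rw [toffoliMap, Function.update_of_ne hj]
            by_cases hj' : j = C
            · subst hj'
              rw [Function.update_self]
              rfl
            rw [Function.update_of_ne hj']
            rcases j with j | (j | j) | j
            · rfl
            · simp only [Sum.elim_inr, Sum.elim_inl, Pi.single_apply, Sum.inl.injEq]
            · have : j ≠ l := fun h => hj (by rw [h])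
              simp [this]
            · exact absurd rfl hj'
        have e2 : toffoliMap L C F
            (Sum.elim y (Sum.elim (Sum.elim (Pi.single f 1) (Pi.single l 1)) fun _ => 1)) =
            Sum.elim y (Sum.elim (Sum.elim 0 (Pi.single l 1)) fun _ => 1) := by
          funext j
          by_cases hj : j = F
          · subst hj
            simp [toffoliMap, L, F, C]
          · rw [toffoliMap, Function.update_of_ne hj]
            rcases j with j | (j | j) | j
            · rfl
            · have : j ≠ f := fun h => hj (by rw [h])
              simp [this]
            · rfl
            · rfl
        rw [e1, e2]
  refine ⟨(R ⊕ R') ⊕ Unit, inferInstance, inferInstance, .inl (.inl f), T,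
    fun z => c * (g (z ∘ .inl ∘ .inl) * g' (z ∘ .inl ∘ .inr)), ?_, ?_, ?_, ?_⟩
  · refine (((hU'.gateOp _).mul (hU.gateOp _)).mul (((hT.toffoli hLC hFL.symm hFC.symm).mul
      (hT.toffoli hFC hFL hLC.symm)).mul (hH.gateOp _))).mono (by omega)
  · rw [sum_sumElim, sum_sumElim]
    simp only [sum_unitArrow]
    have h1 : (∑ z, g z * star (g z)) * ∑ z, g' z * star (g' z) = 1 := by rw [hg, hg', one_mul]
    rw [Finset.sum_mul_sum] at h1
    rw [← h1]
    refine Finset.sum_congr rfl fun p _ => Finset.sum_congr rfl fun p' _ => ?_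
    simp only [← Function.comp_assoc, Sum.elim_comp_inl, Sum.elim_comp_inr, star_mul']
    linear_combination (2 * (g p * star (g p) * (g' p' * star (g' p')))) * hc
  · intro x y z
    obtain ⟨p, p', r, rfl⟩ : ∃ (p : R → Fin 2) (p' : R' → Fin 2) (r : Unit → Fin 2),
        z = Sum.elim (Sum.elim p p') r :=
      ⟨z ∘ .inl ∘ .inl, z ∘ .inl ∘ .inr, z ∘ .inr, by
        funext j; rcases j with (j | j) | j <;> rfl⟩
    have := hTcol (Sum.elim x (Sum.elim (Sum.elim p p') r)) y 0
    rw [Pi.single_zero] at this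
    rw [this]
    have hr : r = (fun _ => 0) ∨ r = fun _ => 1 := by
      have h0 : ∀ b : Fin 2, b = 0 ∨ b = 1 := by decide
      exact (h0 (r ())).imp (fun h => funext fun _ => h) (fun h => funext fun _ => h)
    have h01 : (fun _ : Unit => (0 : Fin 2)) ≠ fun _ => 1 := fun h => by simpa using congrFun h ()
    simp only [hEE, Pi.single_zero, hU0, hU0', ← Function.comp_assoc, Sum.elim_comp_inl,
      Sum.elim_comp_inr]
    rcases hr with rfl | rfl <;> by_cases hxy : x = y <;>
      simp [h01, h01.symm, hxy, mul_comm]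
  · intro x y x' y'
    have h01 : (fun _ : Unit => (0 : Fin 2)) ≠ fun _ => 1 := fun h => by simpa using congrFun h ()
    rw [sum_sumElim, sum_sumElim]
    simp only [sum_unitArrow, hTcol, hEE, if_true, if_neg h01, if_neg h01.symm, add_zero, zero_add,
      hU0, hU0', ite_mul, mul_ite, zero_mul, mul_zero, Finset.sum_ite_eq, Finset.sum_ite_eq',
      Finset.mem_univ]
    rw [← hU1, ← hU1', add_div]
    -- In either branch the idle channel contributes only its normalised garbage, which traces out
    -- to 1.
    have k1 : ∑ p, ∑ p', (U (Sum.elim x p) (Sum.elim y (Pi.single f 1)) *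
        star (U (Sum.elim x' p) (Sum.elim y' (Pi.single f 1)))) * (g' p' * star (g' p')) =
        ∑ p, U (Sum.elim x p) (Sum.elim y (Pi.single f 1)) *
          star (U (Sum.elim x' p) (Sum.elim y' (Pi.single f 1))) := by
      rw [← Finset.sum_mul_sum, hg', mul_one]
    have k2 : ∑ p, ∑ p', (g p * star (g p)) * (U' (Sum.elim x p') (Sum.elim y (Pi.single l 1)) *
        star (U' (Sum.elim x' p') (Sum.elim y' (Pi.single l 1)))) =
        ∑ p', U' (Sum.elim x p') (Sum.elim y (Pi.single l 1)) *
          star (U' (Sum.elim x' p') (Sum.elim y' (Pi.single l 1))) := by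
      rw [← Finset.sum_mul_sum, hg, one_mul]
    rw [← k1, ← k2, ← add_div, ← Finset.sum_add_distrib, Finset.sum_div]
    refine Finset.sum_congr rfl fun p _ => ?_
    rw [← Finset.sum_add_distrib, Finset.sum_div]
    refine Finset.sum_congr rfl fun p' _ => ?_
    simp only [star_mul']
    linear_combination (g' p' * star (g' p') * (U (Sum.elim x p) (Sum.elim y (Pi.single f 1)) *
        star (U (Sum.elim x' p) (Sum.elim y' (Pi.single f 1)))) +
        g p * star (g p) * (U' (Sum.elim x p') (Sum.elim y (Pi.single l 1)) *
        star (U' (Sum.elim x' p') (Sum.elim y' (Pi.single l 1))))) * hc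

/-- The uniform average of `2 ^ t` kernels, along a full binary tree. -/
theorem Flagged.uniform {s t h r : ℕ} (hT : Sim G t toffoliGate) (hH : Sim G h hadamardGate)
    (K : Fin (2 ^ r) → (W → Fin 2) → (W → Fin 2) → (W → Fin 2) → (W → Fin 2) → ℂ)
    (hK : ∀ i, Flagged G s (K i)) :
    Flagged G (2 ^ r * (s + (h + 2 * t))) fun x y x' y' => (∑ i, K i x y x' y') / 2 ^ r := by
  -- The exact count is 2^r leaves and 2^r - 1 inner nodes; this form passes through the induction.
  suffices H : Flagged G (2 ^ r * s + (2 ^ r - 1) * (h + 2 * t))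
      fun x y x' y' => (∑ i, K i x y x' y') / 2 ^ r by
    refine H.mono ?_
    rw [mul_add (2 ^ r)]
    exact Nat.add_le_add_left (Nat.mul_le_mul_right _ (Nat.sub_le _ _)) _
  induction r with
  | zero => simpa using hK 0
  | succ r ih =>
    have e : 2 ^ r + 2 ^ r = 2 ^ (r + 1) := by ring
    have h1 := ih (fun i => K (Fin.cast e (Fin.castAdd _ i))) fun i => hK _
    have h2 := ih (fun i => K (Fin.cast e (Fin.natAdd _ i))) fun i => hK _
    have h3 := Flagged.average hT hH h1 h2
    have hsum : ∀ x y x' y', ∑ i, K i x y x' y' =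
        ∑ i, K (Fin.cast e (Fin.castAdd _ i)) x y x' y' +
          ∑ i, K (Fin.cast e (Fin.natAdd _ i)) x y x' y' := by
      intro x y x' y'
      rw [← (finCongr e).sum_comp, Fin.sum_univ_add]
      rfl
    have hK' : (fun x y x' y' => (∑ i, K i x y x' y') / 2 ^ (r + 1)) = fun x y x' y' =>
        ((∑ i, K (Fin.cast e (Fin.castAdd _ i)) x y x' y') / 2 ^ r +
          (∑ i, K (Fin.cast e (Fin.natAdd _ i)) x y x' y') / 2 ^ r) / 2 := by
      funext x y x' y'
      rw [hsum, ← add_div, div_div, pow_succ (2 : ℂ)]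
    rw [hK']
    refine h3.mono ?_
    obtain ⟨q, hq⟩ : ∃ q, 2 ^ r = q + 1 := ⟨2 ^ r - 1, by have := Nat.one_le_two_pow (n := r); omega⟩
    rw [pow_succ, hq]
    have : (q + 1) * 2 - 1 = q + q + 1 := by omega
    rw [this, Nat.add_sub_cancel]
    exact le_of_eq (by ring)

end Mixture

/-! ### Acceptance probabilities -/

section Acceptance

variable {G : Set Gate} {A B W : Type} [Fintype A] [DecidableEq A] [Fintype B] [DecidableEq B]
  [Fintype W] [DecidableEq W] {n : ℕ}

/-- The probability that the wire `o` is measured as `1`, if the channel with kernel `K` is applied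
to the state `ρ` on the wires `inp` and zeros on the others. -/
def acceptance (inp : Fin n ↪ W) (o : W)
    (K : (W → Fin 2) → (W → Fin 2) → (W → Fin 2) → (W → Fin 2) → ℂ)
    (ρ : Matrix (Bits n) (Bits n) ℂ) : ℝ :=
  (∑ y, ∑ y', ρ y y' * ∑ x : W → Fin 2, if x o = 1 then
    K x (Function.extend inp y 0) x (Function.extend inp y' 0) else 0).re

theorem append_zero_eq_extend {a : ℕ} (y : Bits n) :
    Fin.append y (fun _ : Fin a => (0 : Fin 2)) = Function.extend (Fin.castAddEmb a) y 0 := by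
  funext i
  refine Fin.addCases (fun i => ?_) (fun i => ?_) i
  · rw [Fin.append_left]
    exact ((Fin.castAddEmb a).injective.extend_apply _ _ i).symm
  · rw [Fin.append_right, Function.extend_apply']
    · rfl
    · rintro ⟨j, hj⟩
      have := congrArg Fin.val hj
      simp at this
      omega

theorem trace_diagonal_mul_conj {X Y : Type} [Fintype X] [DecidableEq X] [Fintype Y] (d : X → ℂ)
    (M : Matrix X Y ℂ) (ρ : Matrix Y Y ℂ) :
    (Matrix.diagonal d * (M * ρ * M.conjTranspose)).trace =
      ∑ y, ∑ y', ρ y y' * ∑ x, d x * (M x y * star (M x y')) := by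
  simp only [Matrix.trace, Matrix.diag_apply, Matrix.diagonal_mul]
  simp only [Matrix.mul_apply, Matrix.conjTranspose_apply, Finset.sum_mul, Finset.mul_sum]
  rw [Finset.sum_comm]
  refine (Finset.sum_congr rfl fun _ _ => Finset.sum_comm).trans ?_
  rw [Finset.sum_comm]
  refine Finset.sum_congr rfl fun y _ => Finset.sum_congr rfl fun y' _ =>
    Finset.sum_congr rfl fun x _ => ?_
  ring

theorem acceptance_average {r : ℕ} (inp : Fin n ↪ W) (o : W)
    (K : Fin (2 ^ r) → (W → Fin 2) → (W → Fin 2) → (W → Fin 2) → (W → Fin 2) → ℂ)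
    (ρ : Matrix (Bits n) (Bits n) ℂ) :
    acceptance inp o (fun x y x' y' => (∑ i, K i x y x' y') / 2 ^ r) ρ =
      (∑ i, acceptance inp o (K i) ρ) / 2 ^ r := by
  have e : ∀ y y' : W → Fin 2, (∑ x : W → Fin 2, if x o = 1 then
      (∑ i, K i x y x y') / 2 ^ r else 0) =
      (∑ i, ∑ x : W → Fin 2, if x o = 1 then K i x y x y' else 0) / 2 ^ r := by
    intro y y'
    rw [Finset.sum_comm, Finset.sum_div]
    refine Finset.sum_congr rfl fun x _ => ?_
    split_ifs <;> simp
  have h2 : (2 ^ r : ℂ) = ((2 ^ r : ℝ) : ℂ) := by push_cast; rfl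
  simp only [acceptance, e]
  rw [← Complex.re_sum, h2]
  rw [← Complex.div_ofReal_re]
  congr 1
  simp only [← mul_div_assoc, ← Finset.sum_div, Finset.mul_sum (s := (Finset.univ : Finset (Fin _)))]
  congr 1
  refine (Finset.sum_congr rfl fun _ _ => Finset.sum_comm).trans ?_
  exact Finset.sum_comm

theorem Distinguisher.prob_eq_acceptance (D : Distinguisher G n) (ρ : Matrix (Bits n) (Bits n) ℂ) :
    D.prob ρ = acceptance (Fin.castAddEmb D.ancillas) ⟨0, D.pos⟩
      (channelKernel D.circuit.toMatrix) ρ := by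
  have hcol : ∀ x y, (D.circuit.toMatrix * appendZeros n D.ancillas) x y =
      D.circuit.toMatrix x (Function.extend (Fin.castAddEmb D.ancillas) y 0) := by
    intro x y
    simp [Matrix.mul_apply, appendZeros, append_zero_eq_extend]
  rw [Distinguisher.prob, acceptance]
  congr 1
  have e : D.circuit.toMatrix * (appendZeros n D.ancillas * ρ *
      (appendZeros n D.ancillas).conjTranspose) * D.circuit.toMatrix.conjTranspose =
      (D.circuit.toMatrix * appendZeros n D.ancillas) * ρ *
        (D.circuit.toMatrix * appendZeros n D.ancillas).conjTranspose := by
    rw [Matrix.conjTranspose_mul]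
    simp only [Matrix.mul_assoc]
  rw [e, projFirstOne, trace_diagonal_mul_conj]
  simp only [hcol, channelKernel, ite_mul, one_mul, zero_mul]

/-- Wires outside the range of ι start at zero and are never touched, so only one value of them
contributes to the sum. -/
theorem acceptance_gateOp (inp : Fin n ↪ W) (o : W) (ι : W ↪ B)
    (U : Matrix (W → Fin 2) (W → Fin 2) ℂ) (ρ : Matrix (Bits n) (Bits n) ℂ) :
    acceptance (inp.trans ι) (ι o) (channelKernel (gateOp ι U)) ρ =
      acceptance inp o (channelKernel U) ρ := by
  classical
  have hext : ∀ (y : Bits n), Function.extend (inp.trans ι) y 0 =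
      Function.extend ι (Function.extend inp y (0 : W → Fin 2)) (0 : B → Fin 2) := by
    intro y
    funext j
    by_cases hj : j ∈ Set.range ι
    · obtain ⟨w, rfl⟩ := hj
      rw [ι.injective.extend_apply]
      by_cases hw : w ∈ Set.range inp
      · obtain ⟨i, rfl⟩ := hw
        rw [inp.injective.extend_apply]
        exact (inp.trans ι).injective.extend_apply _ _ i
      · rw [Function.extend_apply' _ _ _ hw, Function.extend_apply']
        · rfl
        · rintro ⟨i, hi⟩
          exact hw ⟨i, ι.injective hi⟩
    · rw [Function.extend_apply' _ _ _ hj, Function.extend_apply']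
      rintro ⟨i, hi⟩
      exact hj ⟨inp i, hi⟩
  rw [acceptance, acceptance]
  congr 1
  refine Finset.sum_congr rfl fun y _ => Finset.sum_congr rfl fun y' _ => ?_
  congr 1
  have key : ∀ (x : B → Fin 2) (u : W → Fin 2), gateOp ι U x (Function.extend ι u 0) =
      if ∀ j, j ∉ Set.range ι → (0 : B → Fin 2) j = x j then U (fun i => x (ι i)) u else 0 := by
    intro x u
    simp only [gateOp, Matrix.of_apply, ι.injective.extend_apply]
    refine if_congr (forall₂_congr fun j hj => ?_) rfl rfl
    rw [Function.extend_apply' _ _ _ hj]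
    exact eq_comm
  have h := sum_agree ι 0 (fun x : B → Fin 2 => if x (ι o) = 1 then
    channelKernel U (fun i => x (ι i)) (Function.extend inp y 0) (fun i => x (ι i))
      (Function.extend inp y' 0) else 0)
  simp only [ι.injective.extend_apply] at h
  refine Eq.trans ?_ h
  refine Finset.sum_congr rfl fun x _ => ?_
  simp only [channelKernel, hext, key]
  split_ifs <;> simp

theorem extend_inj (inp : Fin n ↪ W) {y y' : Bits n} :
    Function.extend inp y (0 : W → Fin 2) = Function.extend inp y' 0 ↔ y = y' := by
  refine ⟨fun h => funext fun i => ?_, fun h => by rw [h]⟩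
  simpa [inp.injective.extend_apply] using congrFun h (inp i)

/-- Flipping the bit o is a bijection of the basis states that exchanges the outcomes; the two
outcome probabilities add up to the trace because U is an isometry. -/
theorem acceptance_not (inp : Fin n ↪ W) (o : W) {U : Matrix (W → Fin 2) (W → Fin 2) ℂ}
    (hU : U.conjTranspose * U = 1) (ρ : Matrix (Bits n) (Bits n) ℂ) :
    acceptance inp o (channelKernel (gateOp (wires1 o) notGate * U)) ρ =
      ρ.trace.re - acceptance inp o (channelKernel U) ρ := by
  have hcol : ∀ y y' : Bits n, ∑ x, channelKernel U x (Function.extend inp y 0) x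
      (Function.extend inp y' 0) = if y' = y then 1 else 0 := by
    intro y y'
    have := congrFun (congrFun hU (Function.extend inp y' 0)) (Function.extend inp y 0)
    rw [Matrix.mul_apply, Matrix.one_apply] at this
    rw [← if_congr (extend_inj inp) rfl rfl, ← this]
    exact Finset.sum_congr rfl fun x _ => by rw [channelKernel, Matrix.conjTranspose_apply, mul_comm]
  have htr : ρ.trace = ∑ y, ∑ y', ρ y y' * ∑ x, channelKernel U x (Function.extend inp y 0) x
      (Function.extend inp y' 0) := by
    simp only [hcol, Matrix.trace, Matrix.diag_apply]
    simp
  rw [acceptance, acceptance, htr, ← Complex.sub_re, ← Finset.sum_sub_distrib]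
  congr 1
  refine Finset.sum_congr rfl fun y _ => ?_
  rw [← Finset.sum_sub_distrib]
  refine Finset.sum_congr rfl fun y' _ => ?_
  rw [← mul_sub, ← Finset.sum_sub_distrib]
  congr 1
  have h2 : ∀ a : Fin 2, a + 1 + 1 = a := by decide
  have hinv : Function.Involutive fun x : W → Fin 2 => Function.update x o (x o + 1) := by
    intro x
    simp [h2]
  let σ : Equiv.Perm (W → Fin 2) := hinv.toPerm _
  rw [← Equiv.sum_comp σ]
  refine Finset.sum_congr rfl fun x _ => ?_
  simp only [channelKernel, gateOp_notGate, permOp_mul_apply]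
  have hx : Function.update (σ x) o (σ x o + 1) = x := hinv x
  simp only [hx]
  have h0 : ∀ b : Fin 2, b = 0 ∨ b = 1 := by decide
  have hxo : σ x o = x o + 1 := Function.update_self o _ x
  rw [hxo]
  rcases h0 (x o) with h | h <;> simp [h]

theorem IsCircuit.exists_distinguisher {s a : ℕ} (hpos : 0 < n + a)
    {U : Matrix (Fin (n + a) ⊕ B → Fin 2) (Fin (n + a) ⊕ B → Fin 2) ℂ} (hU : IsCircuit G s U) :
    ∃ D : Distinguisher G n, D.size = s ∧ ∀ ρ, D.prob ρ =
      acceptance ((Fin.castAddEmb a).trans .inl) (.inl ⟨0, hpos⟩) (channelKernel U) ρ := by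
  let b := Fintype.card B
  let e : Fin (n + a) ⊕ B ≃ Fin (n + (a + b)) :=
    ((Equiv.refl _).sumCongr (Fintype.equivFin B)).trans
      (finSumFinEquiv.trans (finCongr (Nat.add_assoc n a b)))
  obtain ⟨C, hC, hCU⟩ := (hU.gateOp e.toEmbedding).exists_circuit
  refine ⟨⟨a + b, by omega, C⟩, hC, fun ρ => ?_⟩
  rw [Distinguisher.prob_eq_acceptance, ← acceptance_gateOp _ _ e.toEmbedding, hCU]
  rfl

/-- A channel that is available under the control of a qubit yields a distinguisher. -/
theorem Flagged.exists_distinguisher {s t a : ℕ} (hN : Sim G t notGate) (hpos : 0 < n + a)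
    {K : Bits (n + a) → Bits (n + a) → Bits (n + a) → Bits (n + a) → ℂ} (hK : Flagged G s K) :
    ∃ D : Distinguisher G n, D.size ≤ s + t ∧ ∀ ρ, D.prob ρ =
      acceptance (Fin.castAddEmb a) ⟨0, hpos⟩ K ρ := by
  classical
  obtain ⟨R, i1, i2, f, U, g, hU, -, -, h⟩ := hK
  -- A NOT applied first sets the flag, so that starting from all-zero ancillas activates the
  -- channel.
  have hV := hU.mul (hN.gateOp (wires1 (Sum.inr f : Fin (n + a) ⊕ R)))
  have hinv : Function.Involutive fun x : Fin (n + a) ⊕ R → Fin 2 =>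
      Function.update x (.inr f) (x (.inr f) + 1) := by
    have h2 : ∀ a : Fin 2, a + 1 + 1 = a := by decide
    intro x
    simp [h2]
  have hcol : ∀ x y, (U * gateOp (wires1 (Sum.inr f : Fin (n + a) ⊕ R)) notGate) x
      (Sum.elim y 0) = U x (Sum.elim y (Pi.single f 1)) := by
    intro x y
    rw [gateOp_notGate, mul_permOp_apply hinv]
    refine congrArg (U x) (funext fun j => ?_)
    rcases j with j | j
    · simp
    · by_cases hj : j = f
      · subst hj; simp
      · simp [hj]
  obtain ⟨A, i1', i2', V, c, p, hp, hVc, hc, hVV⟩ := hV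
  have hcc : c * star c = 1 := by
    rw [Complex.star_def, Complex.mul_conj', hc]; simp
  let e : (Fin (n + a) ⊕ R) ⊕ A ≃ Fin (n + a) ⊕ (R ⊕ A) := Equiv.sumAssoc _ _ _
  obtain ⟨D, hD, hDp⟩ := (hVc.gateOp e.toEmbedding).exists_distinguisher hpos
  refine ⟨D, hD.trans_le hp, fun ρ => ?_⟩
  have hinp : (Fin.castAddEmb a : Fin n ↪ Fin (n + a)).trans
      (.inl : Fin (n + a) ↪ Fin (n + a) ⊕ (R ⊕ A)) =
      ((Fin.castAddEmb a).trans (Function.Embedding.inl.trans .inl)).trans e.toEmbedding := rfl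
  have ho : (.inl ⟨0, hpos⟩ : Fin (n + a) ⊕ (R ⊕ A)) = e.toEmbedding (.inl (.inl ⟨0, hpos⟩)) := rfl
  rw [hDp, hinp, ho, acceptance_gateOp, acceptance, acceptance]
  congr 1
  refine Finset.sum_congr rfl fun y _ => Finset.sum_congr rfl fun y' _ => ?_
  congr 1
  have hext : ∀ y : Bits n, Function.extend ((Fin.castAddEmb a).trans
      (Function.Embedding.inl.trans (.inl : Fin (n + a) ⊕ R ↪ (Fin (n + a) ⊕ R) ⊕ A))) y
      (0 : (Fin (n + a) ⊕ R) ⊕ A → Fin 2) =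
      Sum.elim (Sum.elim (Function.extend (Fin.castAddEmb a) y 0) 0) 0 := by
    intro y
    funext j
    rcases j with (j | j) | j
    · by_cases hj : j ∈ Set.range (Fin.castAddEmb a)
      · obtain ⟨i, rfl⟩ := hj
        simp only [Sum.elim_inl]
        rw [(Fin.castAddEmb a).injective.extend_apply]
        exact Function.Injective.extend_apply (Function.Embedding.injective _) _ _ i
      · simp only [Sum.elim_inl]
        rw [Function.extend_apply' _ _ _ hj, Function.extend_apply']
        · rfl
        · rintro ⟨i, hi⟩
          exact hj ⟨i, Sum.inl_injective (Sum.inl_injective hi)⟩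
    · rw [Function.extend_apply']
      · rfl
      · rintro ⟨i, hi⟩
        exact absurd (Sum.inl_injective hi) (by simp)
    · rw [Function.extend_apply']
      · rfl
      · rintro ⟨i, hi⟩
        exact absurd hi (by simp)
  simp only [hext, sum_sumElim, Sum.elim_inl, channelKernel, hVV, hcol]
  refine Finset.sum_congr rfl fun x _ => ?_
  by_cases hx : x ⟨0, hpos⟩ = 1
  · simp only [hx, if_true]
    rw [← h]
    refine Finset.sum_congr rfl fun z _ => ?_
    rw [Finset.sum_eq_single 0 (fun w _ hw => by simp [hw]) (by simp)]
    simp only [if_true, star_mul']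
    linear_combination (U (Sum.elim x z) (Sum.elim (Function.extend (Fin.castAddEmb a) y 0)
      (Pi.single f 1)) * star (U (Sum.elim x z) (Sum.elim (Function.extend (Fin.castAddEmb a) y' 0)
      (Pi.single f 1)))) * hcc
  · simp [hx]

/-- Averages of distinguishers and of their negations are distinguishers, with linear overhead. -/
theorem exists_average_distinguisher {K : ℕ} (hK : ∀ g ∈ G, g.1 ≤ K)
    (hG : HasExactBasicGates G) : ∃ c : ℕ, 0 < c ∧
      ∀ (n s r : ℕ) (D : Fin (2 ^ r) → Distinguisher G n) (neg : Fin (2 ^ r) → Prop)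
        [DecidablePred neg], (∀ i, (D i).size ≤ s) →
      ∃ D' : Distinguisher G n, D'.size ≤ 2 ^ r * (c * (s + 1)) ∧ ∀ ρ, D'.prob ρ =
        (∑ i, if neg i then ρ.trace.re - (D i).prob ρ else (D i).prob ρ) / 2 ^ r := by
  classical
  obtain ⟨⟨t₁, hN⟩, ⟨t₂, hH⟩, ⟨t, hT⟩⟩ := hG.imp Implements.sim (And.imp Implements.sim Implements.sim)
  -- The summands are the cost factor of controlling one gate, a controlled NOT for a negated
  -- output, an inner node of the tree, and the NOT that sets the flag. Here t₁, t₂ and t are the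
  -- costs of NOT, Hadamard and Toffoli. The last three do not grow with s, whence s + 1.
  refine ⟨1 + 6 * t * K + (t₁ + 6 * t) + (t₂ + 2 * t) + t₁, by positivity,
    fun n s r D neg _ hs => ?_⟩
  -- All circuits are moved to a common set of wires, large enough for the one with the most
  -- ancillas.
  let a := Finset.univ.sup fun i => (D i).ancillas
  have ha : ∀ i, (D i).ancillas ≤ a := fun i =>
    Finset.le_sup (f := fun i => (D i).ancillas) (Finset.mem_univ i)
  have hpos : 0 < n + a := by
    have h1 := (D ⟨0, by positivity⟩).pos
    have h2 := ha ⟨0, by positivity⟩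
    omega
  let ι : ∀ i, Fin (n + (D i).ancillas) ↪ Fin (n + a) := fun i =>
    Fin.castLEEmb (Nat.add_le_add_left (ha i) n)
  let V : Fin (2 ^ r) → Matrix (Bits (n + a)) (Bits (n + a)) ℂ := fun i =>
    gateOp (ι i) (D i).circuit.toMatrix
  have hV : ∀ i, IsCircuit G (D i).size (V i) := fun i => (D i).circuit.isCircuit.gateOp _
  let o : Fin (n + a) := ⟨0, hpos⟩
  let V' : Fin (2 ^ r) → Matrix (Bits (n + a)) (Bits (n + a)) ℂ := fun i =>
    if neg i then gateOp (wires1 o) notGate * V i else V i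
  have hacc : ∀ i ρ, acceptance (Fin.castAddEmb a) o (channelKernel (V i)) ρ = (D i).prob ρ := by
    intro i ρ
    rw [Distinguisher.prob_eq_acceptance, ← acceptance_gateOp _ _ (ι i)]
    rfl
  have hacc' : ∀ i ρ, acceptance (Fin.castAddEmb a) o (channelKernel (V' i)) ρ =
      if neg i then ρ.trace.re - (D i).prob ρ else (D i).prob ρ := by
    intro i ρ
    simp only [V']
    split_ifs
    · rw [acceptance_not _ _ (hV i).isometry, hacc]
    · exact hacc i ρ
  have hF : ∀ i, Flagged G (s * (1 + 6 * t * K) + (t₁ + 6 * t)) (channelKernel (V' i)) := by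
    intro i
    have h1 : Ctrl G (s * (1 + 6 * t * K)) (V i) :=
      ((hV i).ctrl hT hK).mono (Nat.mul_le_mul_right _ (hs i))
    refine Ctrl.flagged ?_
    simp only [V']
    split_ifs
    · refine (((hT.ctrl hN).gateOp (wires1 o)).mul h1).mono ?_
      simp only [Fintype.card_fin]
      omega
    · exact h1.mono (Nat.le_add_right _ _)
  obtain ⟨D', hD', hp⟩ := (Flagged.uniform hT hH _ hF).exists_distinguisher hN hpos
  refine ⟨D', hD'.trans ?_, fun ρ => ?_⟩
  · have h1 : t₁ ≤ 2 ^ r * t₁ := Nat.le_mul_of_pos_left _ (by positivity)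
    refine (Nat.add_le_add_left h1 _).trans ?_
    rw [← mul_add]
    refine Nat.mul_le_mul_left _ ?_
    nlinarith [Nat.zero_le (s * t), Nat.zero_le (s * t₁), Nat.zero_le (s * t₂),
      Nat.zero_le (t * K)]
  · rw [hp]
    simp only [acceptance_average, ← hacc', o]

end Acceptance

/-! ### Moments of sums of random matrices -/

section Moments

variable {d : Type} [Fintype d] [DecidableEq d]

theorem exists_diagonalization {A : Matrix d d ℂ} (hA : A.IsHermitian) :
    ∃ (U : Matrix d d ℂ) (v : d → ℝ), U.conjTranspose * U = 1 ∧ U * U.conjTranspose = 1 ∧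
      A = U * Matrix.diagonal (fun i => (v i : ℂ)) * U.conjTranspose := by
  refine ⟨hA.eigenvectorUnitary, hA.eigenvalues, Matrix.mem_unitaryGroup_iff'.1
    hA.eigenvectorUnitary.2, Matrix.mem_unitaryGroup_iff.1 hA.eigenvectorUnitary.2, ?_⟩
  exact hA.spectral_theorem

theorem diagonalization_pow {U D : Matrix d d ℂ} (h : U.conjTranspose * U = 1)
    (h' : U * U.conjTranspose = 1) (n : ℕ) :
    (U * D * U.conjTranspose) ^ n = U * D ^ n * U.conjTranspose := by
  induction n with
  | zero => simp [h']
  | succ n ih =>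
    rw [pow_succ, ih, pow_succ]
    calc U * D ^ n * U.conjTranspose * (U * D * U.conjTranspose)
        = U * D ^ n * (U.conjTranspose * U) * (D * U.conjTranspose) := by
          simp only [Matrix.mul_assoc]
      _ = _ := by rw [h]; simp only [Matrix.mul_assoc, Matrix.mul_one]

theorem posSemidef_conj_diag {M : Matrix d d ℂ} (hM : M.PosSemidef) (U : Matrix d d ℂ) (i : d) :
    0 ≤ ((U.conjTranspose * M * U) i i).re :=
  (Complex.le_def.1 (hM.conjTranspose_mul_mul_same U).diag_nonneg).1

theorem posSemidef_sub_sq {B : Matrix d d ℂ} (hB : B.IsHermitian) {b : ℝ}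
    (h1 : (b • (1 : Matrix d d ℂ) - B).PosSemidef) (h2 : (b • (1 : Matrix d d ℂ) + B).PosSemidef) :
    ((b ^ 2) • (1 : Matrix d d ℂ) - B * B).PosSemidef := by
  obtain ⟨U, v, hU, hU', rfl⟩ := exists_diagonalization hB
  have e : ∀ c : ℝ, U.conjTranspose * (c • (1 : Matrix d d ℂ)) * U = c • 1 := fun c => by
    rw [Matrix.mul_smul, Matrix.smul_mul, Matrix.mul_one, hU]
  have e' : U.conjTranspose * (U * Matrix.diagonal (fun i => (v i : ℂ)) * U.conjTranspose) * U =
      Matrix.diagonal (fun i => (v i : ℂ)) := by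
    rw [Matrix.mul_assoc, Matrix.mul_assoc, Matrix.mul_assoc, hU, Matrix.mul_one,
      ← Matrix.mul_assoc, hU, Matrix.one_mul]
  have hv : ∀ i, v i ^ 2 ≤ b ^ 2 := by
    intro i
    have k1 := posSemidef_conj_diag h1 U i
    have k2 := posSemidef_conj_diag h2 U i
    rw [Matrix.mul_sub, Matrix.sub_mul, e, e'] at k1
    rw [Matrix.mul_add, Matrix.add_mul, e, e'] at k2
    simp at k1 k2
    exact sq_le_sq' (by linarith) k1
  have h3 : (b ^ 2) • (1 : Matrix d d ℂ) - U * Matrix.diagonal (fun i => (v i : ℂ)) * U.conjTranspose *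
      (U * Matrix.diagonal (fun i => (v i : ℂ)) * U.conjTranspose) =
      U * Matrix.diagonal (fun i => ((b ^ 2 - v i ^ 2 : ℝ) : ℂ)) * U.conjTranspose := by
    rw [← pow_two (U * _ * _), diagonalization_pow hU hU', Matrix.diagonal_pow]
    have : Matrix.diagonal (fun i => ((b ^ 2 - v i ^ 2 : ℝ) : ℂ)) =
        (b ^ 2) • (1 : Matrix d d ℂ) - Matrix.diagonal ((fun i => (v i : ℂ)) ^ 2) := by
      ext i j
      by_cases hij : i = j
      · subst hij; simp
      · simp [hij]
    rw [this, Matrix.mul_sub, Matrix.sub_mul, Matrix.mul_smul, Matrix.mul_one, Matrix.smul_mul, hU']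
  rw [h3]
  refine Matrix.PosSemidef.mul_mul_conjTranspose_same (Matrix.PosSemidef.diagonal fun i => ?_) U
  exact Complex.zero_le_real.2 (sub_nonneg.2 (hv i))

/-- This is (x^a - y^a)(x^c - y^c) ≥ 0. The exponents have the same parity, so both factors have the
sign of |x| - |y| (even case) or of x - y (odd case), or vanish. -/
theorem add_pow_mul_pow_le (x y : ℝ) (a c : ℕ) (h : Even (a + c)) :
    x ^ a * y ^ c + y ^ a * x ^ c ≤ x ^ (a + c) + y ^ (a + c) := by
  have k : 0 ≤ (x ^ a - y ^ a) * (x ^ c - y ^ c) := by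
    rcases Nat.even_or_odd a with ha | ha
    · have hc : Even c := (Nat.even_add.1 h).1 ha
      rw [← ha.pow_abs x, ← ha.pow_abs y, ← hc.pow_abs x, ← hc.pow_abs y]
      rcases le_total |x| |y| with hxy | hxy
      · exact mul_nonneg_of_nonpos_of_nonpos
          (sub_nonpos.2 (pow_le_pow_left₀ (abs_nonneg _) hxy _))
          (sub_nonpos.2 (pow_le_pow_left₀ (abs_nonneg _) hxy _))
      · exact mul_nonneg (sub_nonneg.2 (pow_le_pow_left₀ (abs_nonneg _) hxy _))
          (sub_nonneg.2 (pow_le_pow_left₀ (abs_nonneg _) hxy _))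
    · have hc : Odd c := by
        rw [← Nat.not_even_iff_odd] at ha ⊢
        exact fun hc => ha ((Nat.even_add.1 h).2 hc)
      rcases le_total x y with hxy | hxy
      · exact mul_nonneg_of_nonpos_of_nonpos (sub_nonpos.2 (ha.strictMono_pow.monotone hxy))
          (sub_nonpos.2 (hc.strictMono_pow.monotone hxy))
      · exact mul_nonneg (sub_nonneg.2 (ha.strictMono_pow.monotone hxy))
          (sub_nonneg.2 (hc.strictMono_pow.monotone hxy))
  rw [pow_add, pow_add]
  linarith

/-- In an eigenbasis of X the trace is the sum of |B_ij|² v_j^a v_i^c. Symmetrising in i and j,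
`add_pow_mul_pow_le` moves all powers onto one eigenvalue, and hb bounds the row sums of |B_ij|² by
b². -/
theorem trace_mul_pow_mul_pow_le {X B : Matrix d d ℂ} (hX : X.IsHermitian) (hB : B.IsHermitian)
    {b : ℝ} (hb : ((b ^ 2) • (1 : Matrix d d ℂ) - B * B).PosSemidef) {a c : ℕ}
    (hac : Even (a + c)) :
    (B * X ^ a * B * X ^ c).trace.re ≤ b ^ 2 * (X ^ (a + c)).trace.re := by
  obtain ⟨U, v, hU, hU', rfl⟩ := exists_diagonalization hX
  set D := Matrix.diagonal (fun i => (v i : ℂ)) with hD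
  set B' := U.conjTranspose * B * U with hB'
  have hBB : B'.IsHermitian := Matrix.isHermitian_conjTranspose_mul_mul U hB
  rw [diagonalization_pow hU hU', diagonalization_pow hU hU', diagonalization_pow hU hU']
  have e1 : (B * (U * D ^ a * U.conjTranspose) * B * (U * D ^ c * U.conjTranspose)).trace =
      (B' * D ^ a * B' * D ^ c).trace := by
    have : B * (U * D ^ a * U.conjTranspose) * B * (U * D ^ c * U.conjTranspose) =
        (B * U * D ^ a * B' * D ^ c) * U.conjTranspose := by
      simp only [hB', Matrix.mul_assoc]
    rw [this, Matrix.trace_mul_comm]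
    simp only [hB', Matrix.mul_assoc]
  have e2 : (U * D ^ (a + c) * U.conjTranspose).trace = ∑ i, ((v i ^ (a + c) : ℝ) : ℂ) := by
    rw [Matrix.trace_mul_comm, ← Matrix.mul_assoc, hU, Matrix.one_mul, hD, Matrix.diagonal_pow,
      Matrix.trace_diagonal]
    simp
  have hsq : ∀ i j, (B' i j * B' j i) = ((‖B' i j‖ ^ 2 : ℝ) : ℂ) := by
    intro i j
    rw [← hBB.apply j i, Complex.star_def, Complex.mul_conj']
    push_cast; rfl
  have e3 : (B' * D ^ a * B' * D ^ c).trace =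
      ∑ i, ∑ j, ((‖B' i j‖ ^ 2 * (v j ^ a * v i ^ c) : ℝ) : ℂ) := by
    rw [hD, Matrix.diagonal_pow, Matrix.diagonal_pow]
    simp only [Matrix.trace, Matrix.diag_apply, Matrix.mul_diagonal]
    refine Finset.sum_congr rfl fun i _ => ?_
    rw [Matrix.mul_apply, Finset.sum_mul]
    refine Finset.sum_congr rfl fun j _ => ?_
    rw [Matrix.mul_diagonal, Complex.ofReal_mul, ← hsq]
    simp only [Pi.pow_apply]
    push_cast
    ring
  have hrow : ∀ i, ∑ j, ‖B' i j‖ ^ 2 ≤ b ^ 2 := by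
    intro i
    have k := posSemidef_conj_diag hb U i
    have : U.conjTranspose * ((b ^ 2) • (1 : Matrix d d ℂ) - B * B) * U =
        (b ^ 2) • 1 - B' * B' := by
      rw [Matrix.mul_sub, Matrix.sub_mul, Matrix.mul_smul, Matrix.smul_mul, Matrix.mul_one, hU]
      congr 1
      calc U.conjTranspose * (B * B) * U = U.conjTranspose * B * 1 * (B * U) := by
            simp only [Matrix.mul_assoc, Matrix.one_mul]
        _ = _ := by rw [← hU']; simp only [hB', Matrix.mul_assoc]
    rw [this] at k
    have k2 : (B' * B') i i = ((∑ j, ‖B' i j‖ ^ 2 : ℝ) : ℂ) := by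
      rw [Matrix.mul_apply, Complex.ofReal_sum]
      exact Finset.sum_congr rfl fun j _ => hsq i j
    rw [Matrix.sub_apply, k2, Matrix.smul_apply, Matrix.one_apply_eq, Complex.sub_re,
      Complex.ofReal_re, Complex.smul_re, Complex.one_re, smul_eq_mul, mul_one] at k
    exact sub_nonneg.1 k
  rw [e1, e2, e3, Complex.re_sum, Complex.re_sum]
  simp only [Complex.re_sum, Complex.ofReal_re]
  have hsymm : ∀ i j, ‖B' i j‖ = ‖B' j i‖ := fun i j => by
    rw [← hBB.apply j i, norm_star]
  have s1 : ∑ i, ∑ j, ‖B' i j‖ ^ 2 * (v j ^ a * v i ^ c) =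
      ∑ i, ∑ j, ‖B' i j‖ ^ 2 * (v i ^ a * v j ^ c) := by
    rw [Finset.sum_comm]
    exact Finset.sum_congr rfl fun i _ => Finset.sum_congr rfl fun j _ => by rw [hsymm]
  have s2 : ∑ i, ∑ j, ‖B' i j‖ ^ 2 * v j ^ (a + c) = ∑ i, ∑ j, ‖B' i j‖ ^ 2 * v i ^ (a + c) := by
    rw [Finset.sum_comm]
    exact Finset.sum_congr rfl fun i _ => Finset.sum_congr rfl fun j _ => by rw [hsymm]
  have s3 : ∑ i, ∑ j, ‖B' i j‖ ^ 2 * (v j ^ a * v i ^ c) +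
      ∑ i, ∑ j, ‖B' i j‖ ^ 2 * (v i ^ a * v j ^ c) ≤
      ∑ i, ∑ j, ‖B' i j‖ ^ 2 * v j ^ (a + c) + ∑ i, ∑ j, ‖B' i j‖ ^ 2 * v i ^ (a + c) := by
    simp only [← Finset.sum_add_distrib, ← mul_add]
    refine Finset.sum_le_sum fun i _ => Finset.sum_le_sum fun j _ =>
      mul_le_mul_of_nonneg_left (add_pow_mul_pow_le _ _ _ _ hac) (sq_nonneg _)
  have s4 : ∑ i, ∑ j, ‖B' i j‖ ^ 2 * v i ^ (a + c) ≤ b ^ 2 * ∑ i, v i ^ (a + c) := by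
    rw [Finset.mul_sum]
    refine Finset.sum_le_sum fun i _ => ?_
    rw [← Finset.sum_mul]
    exact mul_le_mul_of_nonneg_right (hrow i) (hac.pow_nonneg _)
  linarith

/-- The trace moment `tr A ^ n`. -/
def traceMoment (n : ℕ) (A : Matrix d d ℂ) : ℝ := (A ^ n).trace.re

section
attribute [local instance] Matrix.linftyOpNormedRing Matrix.linftyOpNormedAlgebra

/-- The local norm merely makes matrices a normed algebra. In the noncommutative power rule each
summand keeps B at its own position. -/
theorem hasDerivAt_trace_mul_pow (A B E : Matrix d d ℂ) (n : ℕ) (t : ℝ) :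
    HasDerivAt (fun t : ℝ => (E * (A + t • B) ^ n).trace.re)
      (∑ i ∈ Finset.range n,
        (E * ((A + t • B) ^ (n.pred - i) * B * (A + t • B) ^ i)).trace.re) t := by
  have h1 : HasDerivAt (fun t : ℝ => A + t • B) B t := by
    have h := ((hasDerivAt_id t).smul_const B).const_add A
    rw [one_smul] at h
    exact h
  have h2 := h1.fun_pow' n
  let l : Matrix d d ℂ →ₗ[ℝ] ℝ :=
    Complex.reLm ∘ₗ (Matrix.traceLinearMap d ℝ ℂ) ∘ₗ LinearMap.mulLeft ℝ E
  have h3 := (LinearMap.toContinuousLinearMap l).hasFDerivAt.comp_hasDerivAt t h2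
  exact h3.congr_deriv ((map_sum l _ _).trans rfl)

end

/-- By cyclicity of the trace all positions of B give the same value. -/
theorem hasDerivAt_traceMoment (A B : Matrix d d ℂ) (n : ℕ) (t : ℝ) :
    HasDerivAt (fun t : ℝ => traceMoment (n + 1) (A + t • B))
      ((n + 1) * (B * (A + t • B) ^ n).trace.re) t := by
  have h := hasDerivAt_trace_mul_pow A B 1 (n + 1) t
  simp only [Matrix.one_mul] at h
  refine h.congr_deriv ?_
  have : ∀ i ∈ Finset.range (n + 1), ((A + t • B) ^ ((n + 1).pred - i) * B *
      (A + t • B) ^ i).trace.re = (B * (A + t • B) ^ n).trace.re := by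
    intro i hi
    rw [Matrix.trace_mul_comm, ← Matrix.mul_assoc, ← pow_add, Matrix.trace_mul_comm]
    congr 5
    have := Finset.mem_range.1 hi
    simp only [Nat.pred_eq_sub_one]
    omega
  rw [Finset.sum_congr rfl this]
  simp

theorem hasDerivAt_traceMoment_deriv (A B : Matrix d d ℂ) (n : ℕ) (t : ℝ) :
    HasDerivAt (fun t : ℝ => (B * (A + t • B) ^ n).trace.re)
      (∑ i ∈ Finset.range n,
        (B * (A + t • B) ^ (n.pred - i) * B * (A + t • B) ^ i).trace.re) t := by
  refine (hasDerivAt_trace_mul_pow A B B n t).congr_deriv ?_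
  simp only [Matrix.mul_assoc]

theorem nonneg_of_deriv2_nonneg {f f' f'' : ℝ → ℝ} (h1 : ∀ t, HasDerivAt f (f' t) t)
    (h2 : ∀ t, HasDerivAt f' (f'' t) t) (h0 : 0 ≤ f 0) (h0' : 0 ≤ f' 0)
    (h : ∀ t, 0 ≤ t → 0 ≤ f'' t) {t : ℝ} (ht : 0 ≤ t) : 0 ≤ f t := by
  have key : ∀ g g' : ℝ → ℝ, (∀ t, HasDerivAt g (g' t) t) → 0 ≤ g 0 → (∀ t, 0 ≤ t → 0 ≤ g' t) →
      ∀ t, 0 ≤ t → 0 ≤ g t := by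
    intro g g' hg g0 hg' t ht
    have hm : MonotoneOn g (Set.Ici 0) := by
      refine monotoneOn_of_deriv_nonneg (convex_Ici 0)
        (fun x _ => (hg x).continuousAt.continuousWithinAt)
        (fun x _ => (hg x).differentiableAt.differentiableWithinAt) fun x hx => ?_
      rw [(hg x).deriv]
      rw [interior_Ici] at hx
      exact hg' x (le_of_lt hx)
    exact g0.trans (hm (Set.mem_Ici.2 le_rfl) ht ht)
  exact key f f' h1 h0 (key f' f'' h2 h0' h) t ht

variable {ι : Type} [Fintype ι]

/-- The expectation of `φ` at the sum of `T` independent samples of `B i` with weights `w i`. -/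
def sumExpect (w : ι → ℝ) (B : ι → Matrix d d ℂ) : ℕ → (Matrix d d ℂ → ℝ) → ℝ
  | 0, φ => φ 0
  | T + 1, φ => sumExpect w B T fun S => ∑ i, w i * φ (S + B i)

theorem sumExpect_mono {w : ι → ℝ} {B : ι → Matrix d d ℂ} (hw : ∀ i, 0 ≤ w i)
    (hB : ∀ i, (B i).IsHermitian) (T : ℕ) {φ ψ : Matrix d d ℂ → ℝ}
    (h : ∀ S : Matrix d d ℂ, S.IsHermitian → φ S ≤ ψ S) :
    sumExpect w B T φ ≤ sumExpect w B T ψ := by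
  induction T generalizing φ ψ with
  | zero => exact h 0 Matrix.isHermitian_zero
  | succ T ih =>
    exact ih fun S hS => Finset.sum_le_sum fun i _ =>
      mul_le_mul_of_nonneg_left (h _ (hS.add (hB i))) (hw i)

theorem sumExpect_const_mul (w : ι → ℝ) (B : ι → Matrix d d ℂ) (T : ℕ) (c : ℝ)
    (φ : Matrix d d ℂ → ℝ) :
    sumExpect w B T (fun S => c * φ S) = c * sumExpect w B T φ := by
  induction T generalizing φ with
  | zero => rfl
  | succ T ih =>
    rw [sumExpect, sumExpect, ← ih]
    congr 1
    funext S
    rw [Finset.mul_sum]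
    exact Finset.sum_congr rfl fun i _ => by ring

theorem sumExpect_const {w : ι → ℝ} (hw : ∑ i, w i = 1) (B : ι → Matrix d d ℂ) (T : ℕ) (c : ℝ) :
    sumExpect w B T (fun _ => c) = c := by
  induction T with
  | zero => rfl
  | succ T ih =>
    rw [sumExpect, ← Finset.sum_mul, hw, one_mul, ih]

theorem hasDerivAt_sumExpect (w : ι → ℝ) (B : ι → Matrix d d ℂ) (T : ℕ)
    {φ φ' : ℝ → Matrix d d ℂ → ℝ} {t : ℝ} (h : ∀ S, HasDerivAt (fun t => φ t S) (φ' t S) t) :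
    HasDerivAt (fun t => sumExpect w B T (φ t)) (sumExpect w B T (φ' t)) t := by
  induction T generalizing φ φ' with
  | zero => exact h 0
  | succ T ih =>
    exact ih (φ := fun t S => ∑ i, w i * φ t (S + B i)) (φ' := fun t S => ∑ i, w i * φ' t (S + B i))
      fun S => HasDerivAt.fun_sum fun i _ => (h _).const_mul _

/-- Some outcome does not exceed the mean; the samples are fixed one at a time. -/
theorem exists_sum_le_of_sumExpect_le {w : ι → ℝ} (hw : ∀ i, 0 ≤ w i) (hw1 : ∑ i, w i = 1)
    (B : ι → Matrix d d ℂ) (T : ℕ) {φ : Matrix d d ℂ → ℝ} {c : ℝ} (h : sumExpect w B T φ ≤ c) :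
    ∃ f : Fin T → ι, φ (∑ j, B (f j)) ≤ c := by
  induction T generalizing φ with
  | zero => exact ⟨Fin.elim0, by simpa [sumExpect] using h⟩
  | succ T ih =>
    obtain ⟨f, hf⟩ := ih h
    have : ∃ k, φ (∑ j, B (f j) + B k) ≤ c := by
      by_contra! hk
      obtain ⟨k₀, hk₀⟩ : ∃ k, 0 < w k := by
        by_contra! h0
        have : ∑ i, w i ≤ 0 := Finset.sum_nonpos fun i _ => h0 i
        linarith
      have : ∑ i, w i * c < ∑ i, w i * φ (∑ j, B (f j) + B i) :=
        Finset.sum_lt_sum (fun i _ => mul_le_mul_of_nonneg_left (hk i).le (hw i))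
          ⟨k₀, Finset.mem_univ _, mul_lt_mul_of_pos_left (hk k₀) hk₀⟩
      rw [← Finset.sum_mul, hw1, one_mul] at this
      linarith
    obtain ⟨k, hk⟩ := this
    refine ⟨Fin.snoc f k, ?_⟩
    rw [Fin.sum_univ_castSucc]
    simpa using hk

/-- The even trace moments of a sum of `T` independent centered samples. -/
theorem sumExpect_traceMoment_le {w : ι → ℝ} (hw : ∀ i, 0 ≤ w i) (hw1 : ∑ i, w i = 1)
    {B : ι → Matrix d d ℂ} (hB : ∀ i, (B i).IsHermitian) (hB0 : ∑ i, w i • B i = 0) {b : ℝ}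
    (hb : ∀ i, ((b ^ 2) • (1 : Matrix d d ℂ) - B i * B i).PosSemidef) (T p : ℕ) :
    sumExpect w B T (traceMoment (2 * p)) ≤
      Fintype.card d * (∏ j ∈ Finset.range p, ((2 * j + 1) * b ^ 2)) * (T : ℝ) ^ p := by
  have hone : traceMoment 0 = fun _ : Matrix d d ℂ => (Fintype.card d : ℝ) := by
    funext S
    simp [traceMoment]
  induction T generalizing p with
  | zero =>
    cases p with
    | zero => simp [sumExpect, hone]
    | succ p =>
      rw [sumExpect, traceMoment]
      simp [mul_add]
  | succ T ih =>
    -- The last sample is scaled by t, interpolating between T samples (t = 0) and T + 1 samples (t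
    -- = 1). The bound is proved for all t ≥ 0 by induction on p, comparing second derivatives in t.
    have H : ∀ p t, 0 ≤ t →
        sumExpect w B T (fun S => ∑ i, w i * traceMoment (2 * p) (S + t • B i)) ≤
        Fintype.card d * (∏ j ∈ Finset.range p, ((2 * j + 1) * b ^ 2)) * ((T : ℝ) + t ^ 2) ^ p := by
      intro p
      induction p with
      | zero =>
        intro t _
        simp only [mul_zero, hone, ← Finset.sum_mul, hw1, one_mul, sumExpect_const hw1]
        simp
      | succ p ihp =>
        intro t ht
        set C := (Fintype.card d : ℝ) * ∏ j ∈ Finset.range p, ((2 * j + 1) * b ^ 2) with hC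
        have hC0 : 0 ≤ C := by positivity
        rw [Finset.prod_range_succ, ← mul_assoc, ← hC]
        let F : ℝ → ℝ := fun t =>
          sumExpect w B T (fun S => ∑ i, w i * traceMoment (2 * p + 1 + 1) (S + t • B i))
        let F' : ℝ → ℝ := fun t => sumExpect w B T (fun S => ∑ i, w i *
          (((2 * p + 1 : ℕ) + 1) * (B i * (S + t • B i) ^ (2 * p + 1)).trace.re))
        let F'' : ℝ → ℝ := fun t => sumExpect w B T (fun S => ∑ i, w i *
          (((2 * p + 1 : ℕ) + 1) * ∑ k ∈ Finset.range (2 * p + 1),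
            (B i * (S + t • B i) ^ ((2 * p + 1).pred - k) * B i * (S + t • B i) ^ k).trace.re))
        have hF : ∀ t, HasDerivAt F (F' t) t := fun t => hasDerivAt_sumExpect w B T
          (φ := fun t S => ∑ i, w i * traceMoment (2 * p + 1 + 1) (S + t • B i))
          (φ' := fun t S => ∑ i, w i *
            (((2 * p + 1 : ℕ) + 1) * (B i * (S + t • B i) ^ (2 * p + 1)).trace.re)) fun S =>
          HasDerivAt.fun_sum fun i _ => (hasDerivAt_traceMoment S (B i) (2 * p + 1) t).const_mul _
        have hF' : ∀ t, HasDerivAt F' (F'' t) t := fun t => hasDerivAt_sumExpect w B T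
          (φ := fun t S => ∑ i, w i *
            (((2 * p + 1 : ℕ) + 1) * (B i * (S + t • B i) ^ (2 * p + 1)).trace.re))
          (φ' := fun t S => ∑ i, w i *
            (((2 * p + 1 : ℕ) + 1) * ∑ k ∈ Finset.range (2 * p + 1),
            (B i * (S + t • B i) ^ ((2 * p + 1).pred - k) * B i * (S + t • B i) ^ k).trace.re))
          fun S => HasDerivAt.fun_sum fun i _ =>
            ((hasDerivAt_traceMoment_deriv S (B i) (2 * p + 1) t).const_mul _).const_mul _
        -- At t = 0 the derivative is linear in the new sample, which is centred and independent of
        -- S.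
        have hF'0 : F' 0 = 0 := by
          have : ∀ S : Matrix d d ℂ, ∑ i, w i *
              (((2 * p + 1 : ℕ) + 1) * (B i * (S + (0 : ℝ) • B i) ^ (2 * p + 1)).trace.re) = 0 := by
            intro S
            have e : ∑ i, w i * (B i * S ^ (2 * p + 1)).trace.re =
                ((∑ i, w i • B i) * S ^ (2 * p + 1)).trace.re := by
              rw [Finset.sum_mul, Matrix.trace_sum, Complex.re_sum]
              refine Finset.sum_congr rfl fun i _ => ?_
              rw [Matrix.smul_mul, Matrix.trace_smul, Complex.smul_re, smul_eq_mul]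
            simp only [zero_smul, add_zero, mul_left_comm (w _), ← Finset.mul_sum, e, hB0]
            simp
          simp only [F', this]
          exact sumExpect_const hw1 _ _ _
        -- The second derivative is 2p + 2 times a sum of 2p + 1 traces. `trace_mul_pow_mul_pow_le`
        -- bounds each by b² times the moment of order 2p, to which the inductive hypothesis in p
        -- applies.
        have hF'' : ∀ t, 0 ≤ t → F'' t ≤ (2 * p + 2) * ((2 * p + 1) * b ^ 2) *
            (C * ((T : ℝ) + t ^ 2) ^ p) := by
          intro t ht
          refine le_trans ?_ (mul_le_mul_of_nonneg_left (ihp t ht) (by positivity))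
          rw [← sumExpect_const_mul]
          refine sumExpect_mono hw hB T fun S hS => ?_
          rw [Finset.mul_sum]
          refine Finset.sum_le_sum fun i _ => ?_
          rw [mul_left_comm _ (w i)]
          refine mul_le_mul_of_nonneg_left ?_ (hw i)
          have hX : (S + t • B i).IsHermitian := hS.add ((hB i).smul (IsSelfAdjoint.all t))
          have : ∑ k ∈ Finset.range (2 * p + 1), (B i * (S + t • B i) ^ ((2 * p + 1).pred - k) *
              B i * (S + t • B i) ^ k).trace.re ≤
              ∑ k ∈ Finset.range (2 * p + 1), b ^ 2 * traceMoment (2 * p) (S + t • B i) := by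
            refine Finset.sum_le_sum fun k hk => ?_
            have e : (2 * p + 1).pred - k + k = 2 * p := by
              have := Finset.mem_range.1 hk
              simp only [Nat.pred_eq_sub_one]
              omega
            have := trace_mul_pow_mul_pow_le hX (hB i) (hb i)
              (a := (2 * p + 1).pred - k) (c := k) (by rw [e]; exact even_two_mul p)
            rwa [e] at this
          rw [Finset.sum_const, Finset.card_range, nsmul_eq_mul] at this
          push_cast at this ⊢
          calc _ ≤ (2 * (p : ℝ) + 1 + 1) *
                ((2 * p + 1) * (b ^ 2 * traceMoment (2 * p) (S + t • B i))) :=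
                mul_le_mul_of_nonneg_left this (by positivity)
            _ = _ := by ring
        have hF0 : F 0 ≤ C * ((2 * p + 1) * b ^ 2) * (T : ℝ) ^ (p + 1) := by
          have h := ih (p + 1)
          rw [Finset.prod_range_succ, ← mul_assoc, ← hC] at h
          simpa [F, ← Finset.sum_mul, hw1, mul_add] using h
        let Q : ℝ → ℝ := fun t => C * ((2 * p + 1) * b ^ 2) * ((T : ℝ) + t ^ 2) ^ (p + 1)
        let Q' : ℝ → ℝ := fun t => C * ((2 * p + 1) * b ^ 2) *
          ((p + 1) * ((T : ℝ) + t ^ 2) ^ p * (2 * t))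
        let Q'' : ℝ → ℝ := fun t => C * ((2 * p + 1) * b ^ 2) *
          ((p + 1) * (p * ((T : ℝ) + t ^ 2) ^ (p - 1) * (2 * t)) * (2 * t) +
            (p + 1) * ((T : ℝ) + t ^ 2) ^ p * 2)
        have hu : ∀ t : ℝ, HasDerivAt (fun t : ℝ => (T : ℝ) + t ^ 2) (2 * t) t := fun t => by
          simpa using ((hasDerivAt_id t).fun_pow 2).const_add (T : ℝ)
        have hQ : ∀ t, HasDerivAt Q (Q' t) t := fun t => by
          have := ((hu t).fun_pow (p + 1)).const_mul (C * ((2 * p + 1) * b ^ 2))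
          refine this.congr_deriv ?_
          simp [Q']
        have hQ' : ∀ t, HasDerivAt Q' (Q'' t) t := fun t => by
          have := ((((hu t).fun_pow p).const_mul ((p : ℝ) + 1)).fun_mul
            ((hasDerivAt_id t).const_mul 2)).const_mul (C * ((2 * p + 1) * b ^ 2))
          refine this.congr_deriv ?_
          simp [Q'']
        have := nonneg_of_deriv2_nonneg (f := fun t => Q t - F t) (fun t => (hQ t).fun_sub (hF t))
          (fun t => (hQ' t).fun_sub (hF' t))
          (by simpa [Q] using hF0) (by simp [Q', hF'0]) (fun t ht => ?_) ht
        · exact sub_nonneg.1 this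
        · have h1 := hF'' t ht
          -- This summand of Q'' is discarded; the other one is exactly the bound on F''.
          have h2 : 0 ≤ C * ((2 * p + 1) * b ^ 2) *
            ((p + 1) * (p * ((T : ℝ) + t ^ 2) ^ (p - 1) * (2 * t)) * (2 * t)) := by positivity
          have h3 : Q'' t = C * ((2 * p + 1) * b ^ 2) *
            ((p + 1) * (p * ((T : ℝ) + t ^ 2) ^ (p - 1) * (2 * t)) * (2 * t)) +
            (2 * p + 2) * ((2 * p + 1) * b ^ 2) * (C * ((T : ℝ) + t ^ 2) ^ p) := by
            simp only [Q'']
            ring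
          rw [h3]
          linarith
    have h := H p 1 zero_le_one
    simpa [sumExpect] using h

end Moments

/-! ### Sparse averages of observables, uniformly over states -/

section Sampling

variable {d : Type} [Fintype d] [DecidableEq d] {ι : Type} [Fintype ι]

/-- Each even power of an eigenvalue is at most the trace moment, so all eigenvalues lie in [-c, c];
the trace against σ is a convex combination of them. -/
theorem abs_trace_mul_le {S σ : Matrix d d ℂ} (hS : S.IsHermitian) (hσ : IsDensity σ) {p : ℕ}
    (hp : 0 < p) {c : ℝ} (hc : 0 ≤ c) (h : traceMoment (2 * p) S ≤ c ^ (2 * p)) :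
    |(S * σ).trace.re| ≤ c := by
  obtain ⟨U, v, hU, hU', rfl⟩ := exists_diagonalization hS
  have hv : ∀ i, |v i| ≤ c := by
    intro i
    have e : traceMoment (2 * p) (U * Matrix.diagonal (fun i => (v i : ℂ)) * U.conjTranspose) =
        ∑ i, v i ^ (2 * p) := by
      rw [traceMoment, diagonalization_pow hU hU', Matrix.trace_mul_comm, ← Matrix.mul_assoc, hU,
        Matrix.one_mul, Matrix.diagonal_pow, Matrix.trace_diagonal, Complex.re_sum]
      refine Finset.sum_congr rfl fun i _ => ?_
      rw [Pi.pow_apply, ← Complex.ofReal_pow, Complex.ofReal_re]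
    rw [e] at h
    have h1 : v i ^ (2 * p) ≤ ∑ i, v i ^ (2 * p) :=
      Finset.single_le_sum (f := fun i => v i ^ (2 * p))
        (fun i _ => (even_two_mul p).pow_nonneg _) (Finset.mem_univ i)
    rw [← (even_two_mul p).pow_abs] at h1
    exact (pow_le_pow_iff_left₀ (abs_nonneg _) hc (by omega)).1 (h1.trans h)
  have e : (U * Matrix.diagonal (fun i => (v i : ℂ)) * U.conjTranspose * σ).trace.re =
      ∑ i, v i * ((U.conjTranspose * σ * U) i i).re := by
    rw [Matrix.mul_assoc, Matrix.mul_assoc, Matrix.trace_mul_comm, Matrix.mul_assoc, Matrix.trace,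
      Complex.re_sum]
    refine Finset.sum_congr rfl fun i _ => ?_
    rw [Matrix.diag_apply, Matrix.diagonal_mul, Complex.re_ofReal_mul]
  have htr : ∑ i, ((U.conjTranspose * σ * U) i i).re = 1 := by
    have : (U.conjTranspose * σ * U).trace = 1 := by
      rw [Matrix.trace_mul_comm, ← Matrix.mul_assoc, hU', Matrix.one_mul, hσ.2]
    rw [Matrix.trace] at this
    simpa using congrArg Complex.re this
  rw [e]
  calc |∑ i, v i * ((U.conjTranspose * σ * U) i i).re|
      ≤ ∑ i, |v i * ((U.conjTranspose * σ * U) i i).re| := Finset.abs_sum_le_sum_abs _ _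
    _ ≤ ∑ i, c * ((U.conjTranspose * σ * U) i i).re := by
        refine Finset.sum_le_sum fun i _ => ?_
        have h0 := posSemidef_conj_diag hσ.1 U i
        rw [abs_mul, abs_of_nonneg h0]
        exact mul_le_mul_of_nonneg_right (hv i) h0
    _ = c := by rw [← Finset.mul_sum, htr, mul_one]

/-- A convex combination of observables with values in `[-1, 1]` is approximated by the average of
few of them. -/
theorem exists_sparse_average {w : ι → ℝ} (hw : ∀ i, 0 ≤ w i) (hw1 : ∑ i, w i = 1)
    {M : ι → Matrix d d ℂ} (hM : ∀ i, (M i).IsHermitian) (h1 : ∀ i, (1 - M i).PosSemidef)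
    (h2 : ∀ i, (1 + M i).PosSemidef) {η : ℝ} (hη : 0 ≤ η) {p q : ℕ} (hp : 0 < p)
    (hd : Fintype.card d ≤ 2 ^ p) (hq : 16 * p ≤ q * η ^ 2) :
    ∃ f : Fin q → ι, ∀ σ : Matrix d d ℂ, IsDensity σ →
      |∑ j, (M (f j) * σ).trace.re - q * ∑ i, w i * (M i * σ).trace.re| ≤ q * η := by
  let E : Matrix d d ℂ := ∑ i, w i • M i
  let B : ι → Matrix d d ℂ := fun i => M i - E
  have hE : E.IsHermitian := by
    rw [Matrix.IsHermitian, Matrix.conjTranspose_sum]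
    refine Finset.sum_congr rfl fun i _ => ?_
    rw [Matrix.conjTranspose_smul, (hM i).eq, star_trivial]
  have hB : ∀ i, (B i).IsHermitian := fun i => (hM i).sub hE
  have hE1 : (1 - E).PosSemidef := by
    have : 1 - E = ∑ i, w i • (1 - M i) := by
      simp only [smul_sub, Finset.sum_sub_distrib, ← Finset.sum_smul, hw1, one_smul, E]
    rw [this]
    exact Matrix.posSemidef_sum _ fun i _ => (h1 i).smul (hw i)
  have hE2 : (1 + E).PosSemidef := by
    have : 1 + E = ∑ i, w i • (1 + M i) := by
      simp only [smul_add, Finset.sum_add_distrib, ← Finset.sum_smul, hw1, one_smul, E]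
    rw [this]
    exact Matrix.posSemidef_sum _ fun i _ => (h2 i).smul (hw i)
  -- The radius is 2 because both M i and the mean E lie between -1 and 1.
  have hb : ∀ i, (((2 : ℝ) ^ 2) • (1 : Matrix d d ℂ) - B i * B i).PosSemidef := by
    intro i
    refine posSemidef_sub_sq (hB i) ?_ ?_
    · have : (2 : ℝ) • (1 : Matrix d d ℂ) - B i = (1 - M i) + (1 + E) := by
        simp only [B, two_smul]; abel
      rw [this]
      exact (h1 i).add hE2
    · have : (2 : ℝ) • (1 : Matrix d d ℂ) + B i = (1 + M i) + (1 - E) := by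
        simp only [B, two_smul]; abel
      rw [this]
      exact (h2 i).add hE1
  have hB0 : ∑ i, w i • B i = 0 := by
    simp only [B, smul_sub, Finset.sum_sub_distrib, ← Finset.sum_smul, hw1, one_smul, E, sub_self]
  -- Each factor 4(2j + 1) is at most 8p, and the dimension contributes a factor of at most 2 to
  -- each of the p factors, giving (16pq)^p. This is where p must be at least the logarithm of the
  -- dimension.
  have hbound : (Fintype.card d : ℝ) * (∏ j ∈ Finset.range p, ((2 * (j : ℝ) + 1) * (2 : ℝ) ^ 2)) *
      (q : ℝ) ^ p ≤ ((q : ℝ) * η) ^ (2 * p) := by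
    have k1 : ∏ j ∈ Finset.range p, ((2 * (j : ℝ) + 1) * (2 : ℝ) ^ 2) ≤ (8 * (p : ℝ)) ^ p := by
      refine (Finset.prod_le_prod (fun j _ => by positivity) fun j hj => ?_).trans
        (le_of_eq (by rw [Finset.prod_const, Finset.card_range]))
      have : (j : ℝ) + 1 ≤ p := by exact_mod_cast Finset.mem_range.1 hj
      linarith
    have k2 : (Fintype.card d : ℝ) ≤ 2 ^ p := by exact_mod_cast hd
    calc _ ≤ (2 : ℝ) ^ p * (8 * (p : ℝ)) ^ p * (q : ℝ) ^ p := by gcongr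
      _ = ((q : ℝ) * (16 * p)) ^ p := by rw [← mul_pow, ← mul_pow]; ring
      _ ≤ ((q : ℝ) * (q * η ^ 2)) ^ p := by gcongr
      _ = _ := by rw [pow_mul]; ring
  obtain ⟨f, hf⟩ := exists_sum_le_of_sumExpect_le hw hw1 B q
    ((sumExpect_traceMoment_le hw hw1 hB hB0 hb q p).trans hbound)
  refine ⟨f, fun σ hσ => ?_⟩
  have hS : (∑ j, B (f j)).IsHermitian := by
    rw [Matrix.IsHermitian, Matrix.conjTranspose_sum]
    exact Finset.sum_congr rfl fun j _ => (hB _).eq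
  have h := abs_trace_mul_le hS hσ hp (by positivity) hf
  have e : ((∑ j, B (f j)) * σ).trace.re =
      ∑ j, (M (f j) * σ).trace.re - q * ∑ i, w i * (M i * σ).trace.re := by
    have eE : (E * σ).trace.re = ∑ i, w i * (M i * σ).trace.re := by
      rw [Finset.sum_mul, Matrix.trace_sum, Complex.re_sum]
      refine Finset.sum_congr rfl fun i _ => ?_
      rw [Matrix.smul_mul, Matrix.trace_smul, Complex.smul_re, smul_eq_mul]
    rw [Finset.sum_mul, Matrix.trace_sum, Complex.re_sum, ← eE]
    simp only [B, Matrix.sub_mul, Matrix.trace_sub, Complex.sub_re, Finset.sum_sub_distrib]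
    simp
  rwa [e] at h

end Sampling

/-! ### Convexity of the entropy constraint -/

section Entropy

variable {N L : ℕ}

theorem posSemidef_rpow_smul_sub_mono {d : Type} [Fintype d] {A σ : Matrix d d ℂ}
    (hA : A.PosSemidef) {r r' : ℝ} (hr : r ≤ r') (h : (((2 : ℝ) ^ r) • A - σ).PosSemidef) :
    (((2 : ℝ) ^ r') • A - σ).PosSemidef := by
  have e : ((2 : ℝ) ^ r') • A - σ = (((2 : ℝ) ^ r') - (2 : ℝ) ^ r) • A + (((2 : ℝ) ^ r) • A - σ) := by
    rw [sub_smul]; abel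
  rw [e]
  exact (hA.smul (sub_nonneg.2 (Real.rpow_le_rpow_of_exponent_le one_le_two hr))).add h

/-- Quantifying over r strictly above the threshold avoids any claim that the infima are attained.
Operator domination persists when r increases, because the dominating operator is positive. -/
theorem le_condMinEntropy_iff {σ : Matrix (Fin N × Fin L) (Fin N × Fin L) ℂ} {k : ℝ} :
    (k : EReal) ≤ condMinEntropy σ ↔ ∀ r : ℝ, Real.logb 2 N - k < r →
      ∃ τ : Matrix (Fin L) (Fin L) ℂ, IsDensity τ ∧
        (((2 : ℝ) ^ r) • ((N : ℝ)⁻¹ • ((1 : Matrix (Fin N) (Fin N) ℂ) ⊗ₖ τ)) - σ).PosSemidef := by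
  rw [condMinEntropy, EReal.le_sub_iff_add_le (by simp) (by simp), add_comm,
    ← EReal.le_sub_iff_add_le (by simp) (by simp), ← EReal.coe_sub,
    ← EReal.le_of_forall_lt_iff_le]
  constructor
  · intro h r hr
    obtain ⟨r₁, hr₁, hr₁r⟩ := exists_between hr
    have h1 := (h r₁ (by exact_mod_cast hr₁)).trans_lt (EReal.coe_lt_coe_iff.2 hr₁r)
    simp only [iInf_lt_iff, relMinEntropy] at h1
    obtain ⟨τ, hτ, r', hP, hr'⟩ := h1
    refine ⟨τ, hτ, posSemidef_rpow_smul_sub_mono ?_ (EReal.coe_lt_coe_iff.1 hr').le hP⟩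
    exact (Matrix.PosSemidef.one.kronecker hτ.1).smul (by positivity)
  · intro h r hr
    obtain ⟨τ, hτ, hP⟩ := h r (by exact_mod_cast hr)
    exact (iInf₂_le τ hτ).trans (iInf₂_le r hP)

theorem IsDensity.convex_combination {d : Type} [Fintype d] {σ σ' : Matrix d d ℂ}
    (h : IsDensity σ) (h' : IsDensity σ') {a b : ℝ} (ha : 0 ≤ a) (hb : 0 ≤ b) (hab : a + b = 1) :
    IsDensity (a • σ + b • σ') := by
  refine ⟨(h.1.smul ha).add (h'.1.smul hb), ?_⟩
  rw [Matrix.trace_add, Matrix.trace_smul, Matrix.trace_smul, h.2, h'.2, ← add_smul, hab, one_smul]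

/-- For the same r, the witnesses τ of two states can be mixed with the weights of the states. -/
theorem convex_le_condMinEntropy (k : ℝ) :
    Convex ℝ {σ : Matrix (Fin N × Fin L) (Fin N × Fin L) ℂ | (k : EReal) ≤ condMinEntropy σ} := by
  intro σ hσ σ' hσ' a b ha hb hab
  rw [Set.mem_ofPred_eq, le_condMinEntropy_iff] at *
  intro r hr
  obtain ⟨τ, hτ, hP⟩ := hσ r hr
  obtain ⟨τ', hτ', hP'⟩ := hσ' r hr
  refine ⟨a • τ + b • τ', hτ.convex_combination hτ' ha hb hab, ?_⟩
  convert (hP.smul ha).add (hP'.smul hb) using 1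
  rw [Matrix.kronecker_add, Matrix.kronecker_smul, Matrix.kronecker_smul]
  simp only [smul_sub, smul_add, smul_comm a, smul_comm b]
  abel

theorem convex_isDensity {d : Type} [Fintype d] : Convex ℝ {σ : Matrix d d ℂ | IsDensity σ} :=
  fun _ h _ h' _ _ ha hb hab => IsDensity.convex_combination h h' ha hb hab

theorem convex_traceX_eq (ρ : Matrix (Fin N × Fin L) (Fin N × Fin L) ℂ) :
    Convex ℝ {σ : Matrix (Fin N × Fin L) (Fin N × Fin L) ℂ | traceX ρ = traceX σ} := by
  intro σ hσ σ' hσ' a b _ _ hab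
  have e : traceX (a • σ + b • σ') = a • traceX σ + b • traceX σ' := by
    ext i j
    simp [traceX, Finset.sum_add_distrib, Finset.mul_sum]
  rw [Set.mem_ofPred_eq] at *
  rw [e, ← hσ, ← hσ', ← add_smul, hab, one_smul]

end Entropy

/-! ### A finite minimax theorem -/

/-- The vectors strictly above (a i σ)_i for some σ form an open convex set V. If the constant
vector θ is not in V, a hyperplane separates it. Its normal is nonnegative because V is closed
upwards, and nonzero because the separation is strict. With finitely many functions no compactness
of S is needed. -/
theorem exists_forall_lt_or_exists_weights {E ι : Type} [AddCommGroup E] [Module ℝ E] [Fintype ι]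
    {S : Set E} (hS : Convex ℝ S) (hne : S.Nonempty) {a : ι → E → ℝ}
    (ha : ∀ i, ConvexOn ℝ S (a i)) (θ : ℝ) :
    (∃ σ ∈ S, ∀ i, a i σ < θ) ∨ ∃ w : ι → ℝ, (∀ i, 0 ≤ w i) ∧ ∑ i, w i = 1 ∧
      ∀ σ ∈ S, θ ≤ ∑ i, w i * a i σ := by
  classical
  let V : Set (ι → ℝ) := {v | ∃ σ ∈ S, ∀ i, a i σ < v i}
  by_cases hθ : (fun _ => θ) ∈ V
  · exact Or.inl hθ
  right
  have hVc : Convex ℝ V := by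
    rintro v ⟨σ, hσ, hv⟩ v' ⟨σ', hσ', hv'⟩ α β hα hβ hαβ
    refine ⟨α • σ + β • σ', hS hσ hσ' hα hβ hαβ, fun i => ?_⟩
    refine ((ha i).2 hσ hσ' hα hβ hαβ).trans_lt ?_
    simp only [Pi.add_apply, Pi.smul_apply, smul_eq_mul]
    rcases hα.eq_or_lt with rfl | hα
    · have : β = 1 := by linarith
      subst this
      simpa using hv' i
    · have h1 := mul_lt_mul_of_pos_left (hv i) hα
      have h2 := mul_le_mul_of_nonneg_left (hv' i).le hβ
      linarith
  have hVo : IsOpen V := by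
    have : V = ⋃ σ ∈ S, Set.univ.pi fun i => Set.Ioi (a i σ) := by
      ext v; simp [V]
    rw [this]
    exact isOpen_biUnion fun σ _ => isOpen_set_pi Set.finite_univ fun i _ => isOpen_Ioi
  obtain ⟨f, hf⟩ := geometric_hahn_banach_open_point hVc hVo hθ
  let u : ι → ℝ := fun i => -f (Pi.single i 1)
  have hfu : ∀ v, f v = -∑ i, u i * v i := by
    intro v
    conv_lhs => rw [pi_eq_sum_univ' v, map_sum]
    rw [← Finset.sum_neg_distrib]
    refine Finset.sum_congr rfl fun i _ => ?_
    rw [map_smul, smul_eq_mul]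
    simp only [u]
    ring
  have hlow : ∀ σ ∈ S, θ * ∑ i, u i ≤ ∑ i, u i * a i σ := by
    intro σ hσ
    -- The vector (a i σ)_i is only a limit of points of V. The denominator has an absolute value
    -- because the signs of u are not yet known.
    refine le_of_forall_pos_lt_add fun η hη => ?_
    have hk : 0 < 1 + |∑ i, u i| := by positivity
    have h := hf (fun i => a i σ + η / (1 + |∑ i, u i|)) ⟨σ, hσ, fun i => by
      have : 0 < η / (1 + |∑ i, u i|) := by positivity
      linarith⟩
    rw [hfu, hfu, neg_lt_neg_iff] at h
    simp only [mul_add, Finset.sum_add_distrib, ← Finset.sum_mul] at h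
    have h2 : (∑ i, u i) * (η / (1 + |∑ i, u i|)) ≤ η := by
      rw [← mul_div_assoc, div_le_iff₀ hk, mul_comm]
      refine mul_le_mul_of_nonneg_left ?_ hη.le
      linarith [le_abs_self (∑ i, u i)]
    linarith
  obtain ⟨σ₀, hσ₀⟩ := hne
  let v₀ : ι → ℝ := fun i => a i σ₀ + 1
  have hv₀ : v₀ ∈ V := ⟨σ₀, hσ₀, fun i => lt_add_one _⟩
  have hu : ∀ i, 0 ≤ u i := by
    intro i
    by_contra! hi
    -- If u i were negative, moving v₀ upwards in coordinate i would raise f; this t reaches the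
    -- value at θ exactly, contradicting strict separation.
    let t : ℝ := (f (fun _ => θ) - f v₀) / (-u i)
    have ht : 0 ≤ t := div_nonneg (sub_nonneg.2 (hf v₀ hv₀).le) (by linarith)
    have h := hf (v₀ + t • Pi.single i 1) ⟨σ₀, hσ₀, fun j => by
      have : 0 ≤ t * (Pi.single i (1 : ℝ) : ι → ℝ) j := mul_nonneg ht (by
        rw [Pi.single_apply]; split_ifs <;> simp)
      simp only [Pi.add_apply, Pi.smul_apply, smul_eq_mul, v₀]
      linarith⟩
    rw [map_add, map_smul, smul_eq_mul] at h
    have h2 : t * f (Pi.single i 1) = f (fun _ => θ) - f v₀ := by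
      have : f (Pi.single i 1) = -u i := by simp [u]
      rw [this]
      exact div_mul_cancel₀ _ (by linarith)
    linarith
  have hpos : 0 < ∑ i, u i := by
    refine (Finset.sum_nonneg fun i _ => hu i).lt_of_ne fun h0 => ?_
    have hz : ∀ i, u i = 0 := fun i =>
      (Finset.sum_eq_zero_iff_of_nonneg fun i _ => hu i).1 h0.symm i (Finset.mem_univ i)
    have := hf v₀ hv₀
    rw [hfu, hfu] at this
    simp [hz] at this
  refine ⟨fun i => u i / ∑ i, u i, fun i => div_nonneg (hu i) hpos.le, ?_, fun σ hσ => ?_⟩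
  · rw [← Finset.sum_div, div_self hpos.ne']
  · simp only [div_mul_eq_mul_div]
    rw [← Finset.sum_div, le_div_iff₀ hpos]
    exact hlow σ hσ

/-! ### Distinguishers as observables -/

section Observables

variable {G : Set Gate} {N L m l : ℕ}

theorem appendZeros_isometry (n a : ℕ) :
    (appendZeros n a).conjTranspose * appendZeros n a = 1 := by
  ext y y'
  simp [Matrix.mul_apply, appendZeros, Matrix.one_apply, append_eq_append_iff, eq_comm]

theorem QubitEncoding.isometry (e : QubitEncoding N L m l) :
    e.toMatrix.conjTranspose * e.toMatrix = 1 := by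
  ext p p'
  simp [Matrix.mul_apply, QubitEncoding.toMatrix, Matrix.one_apply, append_eq_append_iff,
    Prod.ext_iff, eq_comm]

theorem isometry_mul {X Y Z : Type} [Fintype X] [Fintype Y] [Fintype Z] [DecidableEq Y]
    [DecidableEq Z] {V : Matrix X Y ℂ} {U : Matrix Y Z ℂ} (hV : V.conjTranspose * V = 1)
    (hU : U.conjTranspose * U = 1) : (V * U).conjTranspose * (V * U) = 1 := by
  rw [Matrix.conjTranspose_mul, Matrix.mul_assoc, ← Matrix.mul_assoc _ V U, hV, Matrix.one_mul, hU]

/-- The isometry that a distinguisher applies before the measurement. -/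
def Distinguisher.isometry (e : QubitEncoding N L m l) (D : Distinguisher G (m + l)) :
    Matrix (Bits (m + l + D.ancillas)) (Fin N × Fin L) ℂ :=
  D.circuit.toMatrix * appendZeros (m + l) D.ancillas * e.toMatrix

theorem Distinguisher.isometry_isometry (e : QubitEncoding N L m l)
    (D : Distinguisher G (m + l)) :
    (D.isometry e).conjTranspose * D.isometry e = 1 :=
  isometry_mul (isometry_mul D.circuit.isCircuit.isometry (appendZeros_isometry _ _)) e.isometry

/-- The observable measured by a distinguisher. -/
def Distinguisher.observable (e : QubitEncoding N L m l) (D : Distinguisher G (m + l)) :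
    Matrix (Fin N × Fin L) (Fin N × Fin L) ℂ :=
  (D.isometry e).conjTranspose * projFirstOne D.pos * D.isometry e

theorem accept_eq_trace (e : QubitEncoding N L m l) (D : Distinguisher G (m + l))
    (σ : Matrix (Fin N × Fin L) (Fin N × Fin L) ℂ) :
    accept e D σ = (D.observable e * σ).trace.re := by
  have h : (D.observable e * σ).trace =
      (projFirstOne D.pos * (D.isometry e * σ * (D.isometry e).conjTranspose)).trace := by
    rw [Distinguisher.observable, Matrix.mul_assoc, Matrix.mul_assoc, Matrix.trace_mul_comm]
    simp only [Matrix.mul_assoc]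
  rw [h, accept, Distinguisher.prob, Distinguisher.isometry]
  simp only [Matrix.conjTranspose_mul, Matrix.mul_assoc]

theorem Distinguisher.observable_posSemidef (e : QubitEncoding N L m l)
    (D : Distinguisher G (m + l)) : (D.observable e).PosSemidef := by
  refine Matrix.PosSemidef.conjTranspose_mul_mul_same ?_ _
  refine Matrix.PosSemidef.diagonal fun x => ?_
  split_ifs <;> simp

theorem Distinguisher.one_sub_observable_posSemidef (e : QubitEncoding N L m l)
    (D : Distinguisher G (m + l)) : (1 - D.observable e).PosSemidef := by
  have h : 1 - D.observable e =
      (D.isometry e).conjTranspose * (1 - projFirstOne D.pos) * D.isometry e := by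
    rw [Matrix.mul_sub, Matrix.sub_mul, Matrix.mul_one, D.isometry_isometry e]
    rfl
  rw [h]
  refine Matrix.PosSemidef.conjTranspose_mul_mul_same ?_ _
  rw [projFirstOne, ← Matrix.diagonal_one, Matrix.diagonal_sub]
  refine Matrix.PosSemidef.diagonal fun x => ?_
  simp only [Pi.zero_apply]
  split_ifs <;> simp

theorem trace_encode (e : QubitEncoding N L m l) {σ : Matrix (Fin N × Fin L) (Fin N × Fin L) ℂ}
    (hσ : IsDensity σ) : (e.toMatrix * σ * e.toMatrix.conjTranspose).trace = 1 := by
  rw [Matrix.trace_mul_comm, ← Matrix.mul_assoc, e.isometry, Matrix.one_mul, hσ.2]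

variable {d : Type} [Fintype d] [DecidableEq d]

open scoped MatrixOrder in
theorem trace_mul_nonneg {A σ : Matrix d d ℂ} (hA : A.PosSemidef) (hσ : σ.PosSemidef) :
    0 ≤ (A * σ).trace.re := by
  obtain ⟨B, rfl⟩ := CStarAlgebra.nonneg_iff_eq_star_mul_self.mp hσ.nonneg
  rw [Matrix.star_eq_conjTranspose, ← Matrix.mul_assoc, Matrix.trace_mul_comm, ← Matrix.mul_assoc]
  exact (Complex.le_def.1 (hA.mul_mul_conjTranspose_same B).trace_nonneg).1

theorem accept_mem_Icc (e : QubitEncoding N L m l) (D : Distinguisher G (m + l))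
    {σ : Matrix (Fin N × Fin L) (Fin N × Fin L) ℂ} (hσ : IsDensity σ) :
    accept e D σ ∈ Set.Icc (0 : ℝ) 1 := by
  rw [accept_eq_trace]
  refine ⟨trace_mul_nonneg (D.observable_posSemidef e) hσ.1, ?_⟩
  have h := trace_mul_nonneg (D.one_sub_observable_posSemidef e) hσ.1
  rw [Matrix.sub_mul, Matrix.one_mul, Matrix.trace_sub, hσ.2, Complex.sub_re, Complex.one_re] at h
  linarith

theorem traceMoment_two {A : Matrix d d ℂ} (hA : A.IsHermitian) :
    traceMoment 2 A = ∑ i, ∑ j, ‖A i j‖ ^ 2 := by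
  simp only [traceMoment, pow_two A, Matrix.trace, Matrix.diag_apply, Matrix.mul_apply,
    Complex.re_sum]
  refine Finset.sum_congr rfl fun i _ => Finset.sum_congr rfl fun j _ => ?_
  rw [← hA.apply j i, Complex.star_def, Complex.mul_conj, Complex.ofReal_re, Complex.normSq_eq_norm_sq]

theorem abs_trace_mul_le_of_norm_le {A σ : Matrix d d ℂ} (hA : A.IsHermitian) (hσ : IsDensity σ)
    {r : ℝ} (hr : 0 ≤ r) (h : ∀ i j, ‖A i j‖ ≤ r) :
    |(A * σ).trace.re| ≤ Fintype.card d * r := by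
  refine abs_trace_mul_le hA hσ one_pos (by positivity) ?_
  rw [mul_one, traceMoment_two hA]
  calc ∑ i, ∑ j, ‖A i j‖ ^ 2 ≤ ∑ _i : d, ∑ _j : d, r ^ 2 :=
        Finset.sum_le_sum fun i _ => Finset.sum_le_sum fun j _ =>
          pow_le_pow_left₀ (norm_nonneg _) (h i j) 2
    _ = (Fintype.card d * r) ^ 2 := by simp; ring

/-- From A² ≤ 1 the squared moduli of the entries sum to at most the dimension. The bound is crude
but serves only to show boundedness. -/
theorem norm_apply_le_card {A : Matrix d d ℂ} (h0 : A.PosSemidef) (h1 : (1 - A).PosSemidef)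
    (i j : d) : ‖A i j‖ ≤ Fintype.card d := by
  have h := posSemidef_sub_sq h0.1 (b := 1) (by rwa [one_smul])
    (by rw [one_smul]; exact Matrix.PosSemidef.one.add h0)
  have h2 := (Complex.le_def.1 h.trace_nonneg).1
  rw [one_pow, one_smul, Matrix.trace_sub, Matrix.trace_one, ← pow_two, Complex.sub_re,
    Complex.zero_re, Complex.natCast_re] at h2
  have h3 : traceMoment 2 A ≤ Fintype.card d := by
    rw [traceMoment]; linarith
  rw [traceMoment_two h0.1] at h3
  have h4 : ‖A i j‖ ^ 2 ≤ Fintype.card d :=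
    ((Finset.single_le_sum (f := fun j => ‖A i j‖ ^ 2) (fun _ _ => by positivity)
      (Finset.mem_univ j)).trans
      (Finset.single_le_sum (f := fun i => ∑ j, ‖A i j‖ ^ 2) (fun _ _ => by positivity)
        (Finset.mem_univ i))).trans h3
  have h5 : (1 : ℝ) ≤ Fintype.card d := by
    exact_mod_cast Fintype.card_pos_iff.2 ⟨i⟩
  nlinarith [norm_nonneg (A i j)]

/-- Observables with values in `[0, 1]` form a totally bounded set. -/
theorem exists_finite_net (S : Set (Matrix d d ℂ))
    (hS : ∀ A ∈ S, A.PosSemidef ∧ (1 - A).PosSemidef) {η : ℝ} (hη : 0 < η) :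
    ∃ T : Finset (Matrix d d ℂ), ↑T ⊆ S ∧ ∀ A ∈ S, ∃ A' ∈ T, ∀ σ : Matrix d d ℂ, IsDensity σ →
      |((A - A') * σ).trace.re| ≤ η := by
  classical
  let S' : Set (d → d → ℂ) := {A | Matrix.of A ∈ S}
  have hb : Bornology.IsBounded S' := by
    refine (isBounded_iff_forall_norm_le).2 ⟨Fintype.card d, fun A hA => ?_⟩
    refine (pi_norm_le_iff_of_nonneg (by positivity)).2 fun i =>
      (pi_norm_le_iff_of_nonneg (by positivity)).2 fun j => ?_
    exact norm_apply_le_card (hS _ hA).1 (hS _ hA).2 i j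
  have hr : 0 < η / (Fintype.card d + 1) := by positivity
  -- The centres are taken in the set itself, so that each is the observable of an actual
  -- distinguisher.
  obtain ⟨T, hTS, hT, hcov⟩ := exists_finite_cover_balls_of_isCompact_closure
    hb.isCompact_closure hr
  refine ⟨hT.toFinset.image Matrix.of, ?_, fun A hA => ?_⟩
  · intro A hA
    simp only [Finset.coe_image, Set.mem_image, Finset.mem_coe, Set.Finite.mem_toFinset] at hA
    obtain ⟨B, hB, rfl⟩ := hA
    exact hTS hB
  · have hA' : (fun i j => A i j) ∈ S' := hA
    obtain ⟨B, hB, hAB⟩ := Set.mem_iUnion₂.1 (hcov hA')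
    refine ⟨Matrix.of B, Finset.mem_image_of_mem _ (hT.mem_toFinset.2 hB), fun σ hσ => ?_⟩
    have hH : (A - Matrix.of B).IsHermitian := (hS A hA).1.1.sub (hS _ (hTS hB)).1.1
    refine (abs_trace_mul_le_of_norm_le hH hσ hr.le fun i j => ?_).trans ?_
    · rw [Metric.mem_ball, dist_eq_norm] at hAB
      exact (norm_le_pi_norm (fun j => A i j - B i j) j).trans
        ((norm_le_pi_norm (fun i j => A i j - B i j) i).trans hAB.le)
    · rw [← mul_div_assoc, div_le_iff₀ (by positivity)]
      nlinarith

end Observables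

/-! ### From metric pseudoentropy to HILL pseudoentropy -/

section MetricToHILL

variable {G : Set Gate} {N L m l : ℕ}

/-- A distinguisher without gates. -/
def Distinguisher.trivial (G : Set Gate) (n : ℕ) : Distinguisher G n := ⟨1, n.succ_pos, []⟩

/-- Without gates the number of ancillas is irrelevant. This settles s' = 0, where the size
hypothesis gives no room for sampling. -/
theorem accept_eq_of_size_eq_zero (e : QubitEncoding N L m l) {D D' : Distinguisher G (m + l)}
    (hD : D.size = 0) (hD' : D'.size = 0) (σ : Matrix (Fin N × Fin L) (Fin N × Fin L) ℂ) :
    accept e D σ = accept e D' σ := by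
  have key : ∀ (a b : ℕ) (h : a ≤ b) (pa : 0 < m + l + a) (pb : 0 < m + l + b)
      (ρ : Matrix (Bits (m + l)) (Bits (m + l)) ℂ),
      (⟨a, pa, []⟩ : Distinguisher G (m + l)).prob ρ =
        (⟨b, pb, []⟩ : Distinguisher G (m + l)).prob ρ := by
    intro a b h pa pb ρ
    rw [Distinguisher.prob_eq_acceptance, Distinguisher.prob_eq_acceptance,
      ← acceptance_gateOp _ _ (Fin.castLEEmb (Nat.add_le_add_left h (m + l)))]
    have h1 : ∀ w, Circuit.toMatrix ([] : Circuit G w) = 1 := fun _ => rfl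
    simp only [h1, gateOp_one]
    rfl
  obtain ⟨a, pa, C⟩ := D
  obtain ⟨b, pb, C'⟩ := D'
  obtain rfl : C = [] := List.length_eq_zero_iff.1 hD
  obtain rfl : C' = [] := List.length_eq_zero_iff.1 hD'
  rcases le_total a b with h | h
  · exact key a b h pa pb _
  · exact (key b a h pb pa _).symm

theorem trace_neg_mul_re {d : Type} [Fintype d] (A σ : Matrix d d ℂ) :
    (-A * σ).trace.re = -(A * σ).trace.re := by
  rw [Matrix.neg_mul, Matrix.trace_neg, Complex.neg_re]

/-- If all large distinguishers are fooled by states in the convex set `S`, each by its own one,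
then a single state in `S` fools all small distinguishers. -/
theorem exists_indistinguishable_of_average {c : ℕ}
    (hc : ∀ (n s r : ℕ) (D : Fin (2 ^ r) → Distinguisher G n) (neg : Fin (2 ^ r) → Prop)
      [DecidablePred neg], (∀ i, (D i).size ≤ s) →
      ∃ D' : Distinguisher G n, D'.size ≤ 2 ^ r * (c * (s + 1)) ∧ ∀ ρ, D'.prob ρ =
        (∑ i, if neg i then ρ.trace.re - (D i).prob ρ else (D i).prob ρ) / 2 ^ r)
    (e : QubitEncoding N L m l) {ρ : Matrix (Fin N × Fin L) (Fin N × Fin L) ℂ} (hρ : IsDensity ρ)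
    {S : Set (Matrix (Fin N × Fin L) (Fin N × Fin L) ℂ)} (hS : Convex ℝ S)
    (hSd : ∀ σ ∈ S, IsDensity σ) {ε δ : ℝ} (hδ : 0 < δ) {p r s s' : ℕ} (hp : 0 < p)
    (hd : N * L ≤ 2 ^ p) (hq : 1024 * p ≤ 2 ^ r * δ ^ 2) (hs : 2 ^ r * (c * (s' + 1)) ≤ s)
    (h : ∀ D : Distinguisher G (m + l), D.size ≤ s →
      ∃ σ ∈ S, |accept e D ρ - accept e D σ| < ε) :
    ∃ σ ∈ S, Indistinguishable G e s' (ε + δ) ρ σ := by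
  classical
  have hne : S.Nonempty := by
    obtain ⟨σ, hσ, -⟩ := h (Distinguisher.trivial G _) (Nat.zero_le s)
    exact ⟨σ, hσ⟩
  obtain ⟨T, hTS, hT⟩ := exists_finite_net
    {A | ∃ D : Distinguisher G (m + l), D.size ≤ s' ∧ D.observable e = A}
    (by
      rintro _ ⟨D, -, rfl⟩
      exact ⟨D.observable_posSemidef e, D.one_sub_observable_posSemidef e⟩)
    (η := δ / 8) (by positivity)
  choose Dt hDs hDt using fun A : T => hTS A.2
  -- Both signs are included, so that one-sided bounds on all M i control absolute values.
  let M : T × Bool → Matrix (Fin N × Fin L) (Fin N × Fin L) ℂ := fun i => if i.2 then -i.1 else i.1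
  have hM : ∀ i, (M i).IsHermitian ∧ (1 - M i).PosSemidef ∧ (1 + M i).PosSemidef := by
    intro i
    have h0 := (Dt i.1).observable_posSemidef e
    have h1 := (Dt i.1).one_sub_observable_posSemidef e
    rw [hDt] at h0 h1
    have h2 := Matrix.PosSemidef.one.add h0
    simp only [M]
    split_ifs
    · refine ⟨h0.1.neg, ?_, ?_⟩
      · rwa [sub_neg_eq_add]
      · rwa [← sub_eq_add_neg]
    · exact ⟨h0.1, h1, h2⟩
  have hconv : ∀ i, ConvexOn ℝ S fun σ => (M i * ρ).trace.re - (M i * σ).trace.re := by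
    refine fun i => ⟨hS, fun σ _ σ' _ a b _ _ hab => le_of_eq ?_⟩
    simp only [Matrix.mul_add, Matrix.mul_smul, Matrix.trace_add, Matrix.trace_smul,
      Complex.add_re, Complex.smul_re, smul_eq_mul]
    linear_combination -(M i * ρ).trace.re * hab
  -- In the first case the net costs δ/8 for ρ and for σ, so the gap stays below ε + 3δ/4. In the
  -- second, sampling costs δ/8 for each, which leaves a gap of at least ε + δ/4.
  rcases exists_forall_lt_or_exists_weights hS hne hconv (ε + δ / 2) with
    ⟨σ, hσ, ha⟩ | ⟨w, hw, hw1, ha⟩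
  · refine ⟨σ, hσ, fun D hD => ?_⟩
    obtain ⟨A, hA, hAD⟩ := hT _ ⟨D, hD, rfl⟩
    have h1 := ha (⟨A, hA⟩, false)
    have h2 := ha (⟨A, hA⟩, true)
    have h3 := hAD ρ hρ
    have h4 := hAD σ (hSd σ hσ)
    simp only [M, Bool.false_eq_true, if_true, if_false, trace_neg_mul_re] at h1 h2
    rw [Matrix.sub_mul, Matrix.trace_sub, Complex.sub_re, abs_le] at h3 h4
    rw [accept_eq_trace, accept_eq_trace, abs_le]
    constructor <;> linarith
  · exfalso
    -- With accuracy δ/8 the condition 16p ≤ q(δ/8)² is the hypothesis with 1024.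
    obtain ⟨f, hf⟩ := exists_sparse_average hw hw1 (fun i => (hM i).1) (fun i => (hM i).2.1)
      (fun i => (hM i).2.2) (η := δ / 8) (by positivity) (q := 2 ^ r) hp
      (by simpa using hd) (by push_cast; linarith)
    obtain ⟨D', hD's, hD'⟩ := hc (m + l) s' r (fun j => Dt (f j).1) (fun j => (f j).2 = true)
      (fun j => hDs _)
    obtain ⟨σ, hσ, hlt⟩ := h D' (hD's.trans hs)
    -- A negated distinguisher has value 1 - A rather than -A; the constants are the same for ρ and
    -- σ and cancel in the difference.
    have hacc : ∀ τ, IsDensity τ → accept e D' τ =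
        (∑ j, ((if (f j).2 = true then 1 else 0) + (M (f j) * τ).trace.re)) / 2 ^ r := by
      intro τ hτ
      rw [accept, hD', trace_encode e hτ]
      congr 1
      refine Finset.sum_congr rfl fun j _ => ?_
      have hj : (Dt (f j).1).prob (e.toMatrix * τ * e.toMatrix.conjTranspose) =
          (((f j).1 : Matrix (Fin N × Fin L) (Fin N × Fin L) ℂ) * τ).trace.re := by
        rw [← hDt]
        exact accept_eq_trace e _ τ
      rw [hj]
      simp only [M]
      split_ifs
      · rw [trace_neg_mul_re, Complex.one_re]; ring
      · rw [zero_add]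
    have h1 := abs_le.1 (hf ρ hρ)
    have h2 := abs_le.1 (hf σ (hSd σ hσ))
    have h3 := ha σ hσ
    simp only [mul_sub, Finset.sum_sub_distrib] at h3
    have h4 := lt_of_abs_lt hlt
    rw [hacc ρ hρ, hacc σ (hSd σ hσ), Finset.sum_add_distrib, Finset.sum_add_distrib, ← sub_div,
      div_lt_iff₀ (by positivity)] at h4
    push_cast at h1 h2
    have hq0 : (0 : ℝ) < 2 ^ r := by positivity
    have h5 := mul_le_mul_of_nonneg_left h3 hq0.le
    have h6 := mul_pos hq0 hδ
    linarith

/-- Here p is the logarithm rounded up, at most twice the logarithm because D ≥ 2. Rounding 1024p/δ²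
up to a power of two costs another factor 2, which gives 4096. -/
theorem exists_sample_size {D δ : ℝ} (hD : 2 ≤ D) (hδ : 0 < δ) (hδ1 : δ ≤ 1) :
    ∃ p r : ℕ, 0 < p ∧ D ≤ 2 ^ p ∧ 1024 * p ≤ 2 ^ r * δ ^ 2 ∧
      2 ^ r * δ ^ 2 ≤ 4096 * Real.logb 2 D := by
  have hlog : 1 ≤ Real.logb 2 D := by
    rw [Real.le_logb_iff_rpow_le one_lt_two (by linarith), Real.rpow_one]; exact hD
  have hp0 : 0 < ⌈Real.logb 2 D⌉₊ := Nat.ceil_pos.2 (by linarith)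
  have hp := Nat.ceil_lt_add_one (show 0 ≤ Real.logb 2 D by linarith)
  have hp1 : (1 : ℝ) ≤ ⌈Real.logb 2 D⌉₊ := by exact_mod_cast hp0
  have hX : 1 ≤ 1024 * (⌈Real.logb 2 D⌉₊ : ℝ) / δ ^ 2 := by
    rw [one_le_div (by positivity)]
    nlinarith
  obtain ⟨r, hr, hr'⟩ := exists_nat_pow_near hX one_lt_two
  rw [le_div_iff₀ (by positivity)] at hr
  rw [div_lt_iff₀ (by positivity)] at hr'
  refine ⟨_, r + 1, hp0, ?_, hr'.le, ?_⟩
  · have := Nat.le_ceil (Real.logb 2 D)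
    rw [Real.logb_le_iff_le_rpow one_lt_two (by linarith), Real.rpow_natCast] at this
    exact this
  · rw [pow_succ]
    linarith

theorem IsDensity.card_pos {d : Type} [Fintype d] {ρ : Matrix d d ℂ} (hρ : IsDensity ρ) :
    0 < Fintype.card d := by
  rw [Fintype.card_pos_iff]
  by_contra h
  rw [not_nonempty_iff] at h
  have := hρ.2
  simp [Matrix.trace] at this

theorem IsDensity.eq_of_card_eq_one {d : Type} [Fintype d] {ρ σ : Matrix d d ℂ}
    (hρ : IsDensity ρ) (hσ : IsDensity σ) (hd : Fintype.card d = 1) : ρ = σ := by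
  obtain ⟨x, hx⟩ := Fintype.card_eq_one_iff.1 hd
  have htr := hρ.2.trans hσ.2.symm
  have : Unique d := ⟨⟨x⟩, hx⟩
  ext i j
  rw [Subsingleton.elim i default, Subsingleton.elim j default]
  simpa [Matrix.trace] using htr

/-- The set S is left abstract because the two claims differ only in whether it fixes the reduced
state. The main case needs s' ≥ 1, δ ≤ 1 and NL ≥ 2; the others are trivial for any state of S that
the hypothesis supplies. -/
theorem exists_indistinguishable {K : ℕ} (hK : ∀ g ∈ G, g.1 ≤ K) (hG : HasExactBasicGates G) :
    ∃ C : ℝ, 0 < C ∧ ∀ (N L m l : ℕ) (e : QubitEncoding N L m l)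
      (ρ : Matrix (Fin N × Fin L) (Fin N × Fin L) ℂ), IsDensity ρ →
      ∀ (S : Set (Matrix (Fin N × Fin L) (Fin N × Fin L) ℂ)), Convex ℝ S →
      (∀ σ ∈ S, IsDensity σ) → ∀ ε δ : ℝ, 0 < δ → ∀ s s' : ℕ,
      (s' : ℝ) * (C * ((Real.logb 2 N + Real.logb 2 L) / δ ^ 2)) ≤ s →
      (∀ D : Distinguisher G (m + l), D.size ≤ s →
        ∃ σ ∈ S, |accept e D ρ - accept e D σ| < ε) →
      ∃ σ ∈ S, Indistinguishable G e s' (ε + δ) ρ σ := by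
  obtain ⟨c, hc0, hc⟩ := exists_average_distinguisher hK hG
  refine ⟨8192 * c, by positivity, fun N L m l e ρ hρ S hS hSd ε δ hδ s s' hs h => ?_⟩
  have hNL : 0 < N * L := by simpa using hρ.card_pos
  obtain ⟨σ, hσ, hlt⟩ := h (Distinguisher.trivial G _) (Nat.zero_le s)
  have hε : 0 < ε := (abs_nonneg _).trans_lt hlt
  rcases Nat.eq_zero_or_pos s' with rfl | hs'
  · refine ⟨σ, hσ, fun D hD => ?_⟩
    have hD0 : D.size = 0 := Nat.le_zero.1 hD
    rw [accept_eq_of_size_eq_zero e (D' := Distinguisher.trivial G _) hD0 rfl,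
      accept_eq_of_size_eq_zero e (D' := Distinguisher.trivial G _) hD0 rfl]
    linarith
  rcases lt_or_ge 1 δ with hδ1 | hδ1
  · refine ⟨σ, hσ, fun D _ => ?_⟩
    have h1 := accept_mem_Icc e D hρ
    have h2 := accept_mem_Icc e D (hSd σ hσ)
    rw [abs_le]
    constructor <;> linarith [h1.1, h1.2, h2.1, h2.2]
  -- In dimension one the logarithms vanish and the size hypothesis is void, but there is only one
  -- density operator.
  rcases (Nat.succ_le_iff.2 hNL).eq_or_lt with h1 | h2
  · refine ⟨σ, hσ, fun D _ => ?_⟩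
    rw [hρ.eq_of_card_eq_one (hSd σ hσ) (by simpa using h1.symm), sub_self, abs_zero]
    linarith
  · obtain ⟨p, r, hp, hd, hq, hr⟩ := exists_sample_size (D := (N * L : ℕ))
      (by exact_mod_cast h2) hδ hδ1
    refine exists_indistinguishable_of_average hc e hρ hS hSd hδ hp (by exact_mod_cast hd) hq ?_ h
    have hN : (N : ℝ) ≠ 0 := by
      rintro h0; simp [Nat.cast_eq_zero.1 h0] at hNL
    have hL : (L : ℝ) ≠ 0 := by
      rintro h0; simp [Nat.cast_eq_zero.1 h0] at hNL
    rw [← Real.logb_mul hN hL, ← Nat.cast_mul] at hs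
    have hs1 : (1 : ℝ) ≤ s' := by exact_mod_cast hs'
    rw [← le_div_iff₀ (by positivity)] at hr
    suffices ((2 ^ r * (c * (s' + 1)) : ℕ) : ℝ) ≤ s by exact_mod_cast this
    refine le_trans ?_ hs
    push_cast
    -- The step s' + 1 ≤ 2s' accounts for the passage from 4096 to 8192.
    calc (2 : ℝ) ^ r * (c * (s' + 1))
        ≤ (4096 * Real.logb 2 (N * L : ℕ) / δ ^ 2) * (c * (2 * s')) := by
          refine mul_le_mul hr (mul_le_mul_of_nonneg_left (by linarith) (by positivity))
            (by positivity) ((by positivity : (0 : ℝ) ≤ 2 ^ r).trans hr)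
      _ = s' * (8192 * c * (Real.logb 2 (N * L) / δ ^ 2)) := by push_cast; ring

end MetricToHILL

end

end QuantumPseudoentropy

theorem mainTheorem7 (G : Set QuantumPseudoentropy.Gate)
    (hG : QuantumPseudoentropy.IsUniversal G)
    (hG' : QuantumPseudoentropy.HasExactBasicGates G) :
    ∃ C : ℝ, 0 < C ∧
      ∀ (N L m l : ℕ) (e : QuantumPseudoentropy.QubitEncoding N L m l)
        (ρ : Matrix (Fin N × Fin L) (Fin N × Fin L) ℂ), QuantumPseudoentropy.IsDensity ρ →
      ∀ (k ε δ : ℝ), 0 < δ →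
      ∀ s s' : ℕ,
        (s' : ℝ) * (C * ((Real.logb 2 N + Real.logb 2 L) / δ ^ 2)) ≤ (s : ℝ) →
        (QuantumPseudoentropy.Metric G e s ε k ρ →
          QuantumPseudoentropy.HILL G e s' (ε + δ) k ρ) ∧
        (QuantumPseudoentropy.RelaxedMetric G e s ε k ρ →
          QuantumPseudoentropy.RelaxedHILL G e s' (ε + δ) k ρ) := by
  obtain ⟨K, hK⟩ := hG.1
  obtain ⟨C, hC, H⟩ := QuantumPseudoentropy.exists_indistinguishable hK hG'
  refine ⟨C, hC, fun N L m l e ρ hρ k ε δ hδ s s' hs => ⟨fun h => ?_, fun h => ?_⟩⟩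
  · obtain ⟨σ, ⟨hσ, hσB, hσk⟩, hind⟩ := H N L m l e ρ hρ _
      (QuantumPseudoentropy.convex_isDensity.inter
        ((QuantumPseudoentropy.convex_traceX_eq ρ).inter
          (QuantumPseudoentropy.convex_le_condMinEntropy k)))
      (fun σ hσ => hσ.1) ε δ hδ s s' hs fun D hD => by
        obtain ⟨σ, h1, h2, h3, h4⟩ := h D hD
        exact ⟨σ, ⟨h1, h2, h3⟩, h4⟩
    exact ⟨σ, hσ, hσB, hσk, hind⟩
  · obtain ⟨σ, ⟨hσ, hσk⟩, hind⟩ := H N L m l e ρ hρ _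
      (QuantumPseudoentropy.convex_isDensity.inter
        (QuantumPseudoentropy.convex_le_condMinEntropy k))
      (fun σ hσ => hσ.1) ε δ hδ s s' hs fun D hD => by
        obtain ⟨σ, h1, h2, h3⟩ := h D hD
        exact ⟨σ, ⟨h1, h2⟩, h3⟩
    exact ⟨σ, hσ, hσk, hind⟩
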